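/- Let $V$ be a finite-dimensional real vector space with a non-degenerate symmetric bilinear form $Q$ (for example $V=H\otimes_{\mathbb Q}\mathbb R$ for a rational quadratic space $(H,Q)$), and let $m\ge 0$, $n=2m$. Write $V_{\mathbb C}=V\otimes\mathbb C$. A Hodge structure of weight $n$ on $V$ is a filtration $F^n\subset\dots\subset F^0=V_{\mathbb C}$ with $V_{\mathbb C}=F^p\oplus\overline{F^{\,n-p+1}}$ for all $p$ (where $F^{n+1}=0$); put $H^{p,q}=F^p\cap\overline{F^q}$. It is polarized by $Q$ if $Q(F^p,F^{n-p+1})=0$ for all $p$ and $Q(Cu,\bar u)>0$ for all $0\ne u\in V_{\mathbb C}$, where $C$ is the Weil operator, acting as $i^{p-q}$ on $H^{p,q}$. Fix numbers $h^{p,q}$ $(p+q=n)$ and let $D$ be the period domain of all Hodge structures of weight $n$ on $V$ polarized by $Q$ with $\dim H^{p,q}=h^{p,q}$. It lies in the product over $0\le p\le n$ of the Grassmannians of subspaces of $V_{\mathbb C}$, from which it has its complex structure. Let $F\in D$, and let $0\neq\zeta\in V$ be a real vector which is of type $(m,m)$ at $F$, i.e. $\zeta\in H^{m,m}$. Let $D_\zeta\subset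 D$ be the Noether–Lefschetz locus, i.e. the set of points of $D$ at which $\zeta$ is of type $(m,m)$. Let $G_{\mathbb R}=\mathrm{Aut}(V,Q)$ and let $G_\zeta\subset G_{\mathbb R}$ be the subgroup of those elements that fix $\zeta$ up to scaling. **Proposition.** $D_\zeta=G_\zeta\cdot F$ is the $G_\zeta$-orbit of $F$. It is homogeneous, that is, $G_\zeta$ acts transitively on $D_\zeta$, the action being holomorphic in the point and analytic in the group element. It is a complex submanifold of $D$ of codimension $$\operatorname{codim}_D D_\zeta=h^{2m,0}+h^{2m-1,1}+\dots+h^{m+1,m-1}$$ (an empty sum, equal to $0$, when $m=0$). -/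

import Mathlib

open scoped TensorProduct Topology

namespace NoetherLefschetz

section Grassmannians

variable {W : Type*} [AddCommGroup W] [Module ℂ W]

/-- A point of the product over `p = 0, …, n` of the Grassmannians of a complex vector space `W`:
a family `F⁰, …, Fⁿ` of complex subspaces of `W`. -/
abbrev Family (W : Type*) [AddCommGroup W] [Module ℂ W] (n : ℕ) : Type _ :=
  Fin (n + 1) → Submodule ℂ W

/-- The image of a family of subspaces under a linear endomorphism. -/
def Family.map {n : ℕ} (T : W →ₗ[ℂ] W) (F : Family W n) : Family W n :=
  fun p => (F p).map T

/-- Data of a standard affine chart of the product of Grassmannians centred at `F`: for each `p`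
a basis of `W` which begins with a basis of `F p`; the remaining basis vectors span a complement
of `F p`. -/
structure AffineChart {n : ℕ} (F : Family W n) where
  /-- the dimension of `F p` -/
  k : Fin (n + 1) → ℕ
  /-- the codimension of `F p` -/
  l : Fin (n + 1) → ℕ
  /-- the basis adapted to `F p` -/
  basis : ∀ p, Module.Basis (Fin (k p) ⊕ Fin (l p)) ℂ W
  span_eq : ∀ p, Submodule.span ℂ (Set.range fun i => basis p (Sum.inl i)) = F p

/-- The coordinate space of the affine chart. -/
abbrev AffineChart.Coord {n : ℕ} {F : Family W n} (κ : AffineChart F) : Type :=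
  ∀ p : Fin (n + 1), Fin (κ.k p) → Fin (κ.l p) → ℂ

/-- The family of subspaces with affine coordinates `z`: its `p`-th member is the graph of the
linear map `F p → (complement of F p)` whose matrix is `z p`. These maps, the inverses of the
affine charts, define the complex manifold structure of the product of Grassmannians. The origin
has coordinates of the centre `F`. -/
def AffineChart.param {n : ℕ} {F : Family W n} (κ : AffineChart F) (z : κ.Coord) : Family W n :=
  fun p => Submodule.span ℂ (Set.range fun i =>
    κ.basis p (Sum.inl i) + ∑ j, z p i j • κ.basis p (Sum.inr j))

/-- `S ⊆ D` are subsets of the product of Grassmannians, and `S` is an (embedded) complex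
submanifold of `D`, of codimension `c`: around each point of `S` there are affine coordinates, a
neighbourhood `U` of the origin, and holomorphic functions `u = (u₁, …, u_e)` and
`w = (w₁, …, w_c)` on `U` with `d(u₁, …, u_e, w₁, …, w_c)` of rank `e + c` on `U`, such that
in `U` the set `D` is `{u = 0}` and `S` is `{u = 0, w = 0}`. (So `D` is itself a complex
submanifold of the product of Grassmannians near `S`, cut out by `u`, and `S` is cut out in `D`
by `c` further independent equations.) -/
def IsComplexSubmanifoldOfCodim {n : ℕ} (S D : Set (Family W n)) (c : ℕ) : Prop :=
  S ⊆ D ∧ ∀ x ∈ S, ∃ (κ : AffineChart x) (e : ℕ) (U : Set κ.Coord)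
    (u : κ.Coord → (Fin e → ℂ)) (w : κ.Coord → (Fin c → ℂ)),
    IsOpen U ∧ 0 ∈ U ∧ DifferentiableOn ℂ u U ∧ DifferentiableOn ℂ w U ∧
    (∀ z ∈ U, Function.Surjective (fderiv ℂ (fun y => (u y, w y)) z)) ∧
    (∀ z ∈ U, (κ.param z ∈ D ↔ u z = 0)) ∧
    (∀ z ∈ U, (κ.param z ∈ S ↔ u z = 0 ∧ w z = 0))

/-- The map `(T, y) ↦ T y`, from pairs of a linear endomorphism and a point of the product of
Grassmannians, is defined and holomorphic near `(T₀, x)`; here `T` is described by its matrix in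
a basis of `W`, and `y` and `T y` by affine coordinates. -/
def ActsHolomorphicallyAt [FiniteDimensional ℂ W] {n : ℕ} (T₀ : W →ₗ[ℂ] W) (x : Family W n) :
    Prop :=
  ∃ (κ : AffineChart x) (κ' : AffineChart (x.map T₀))
    (ψ : (Fin (Module.finrank ℂ W) → Fin (Module.finrank ℂ W) → ℂ) × κ.Coord → κ'.Coord),
    AnalyticAt ℂ ψ
      (fun i j => LinearMap.toMatrix (Module.finBasis ℂ W) (Module.finBasis ℂ W) T₀ i j, 0) ∧
    ∀ᶠ q in 𝓝 ((fun i j =>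
        LinearMap.toMatrix (Module.finBasis ℂ W) (Module.finBasis ℂ W) T₀ i j, 0) :
        (Fin (Module.finrank ℂ W) → Fin (Module.finrank ℂ W) → ℂ) × κ.Coord),
      (κ.param q.2).map
        (Matrix.toLin (Module.finBasis ℂ W) (Module.finBasis ℂ W) (Matrix.of q.1)) =
      κ'.param (ψ q)

end Grassmannians

section HodgeStructures

variable {V : Type*} [AddCommGroup V] [Module ℝ V]

/-- Complex conjugation on the complexification `ℂ ⊗ V` of a real vector space. -/
noncomputable def conj : (ℂ ⊗[ℝ] V) →ₛₗ[starRingEnd ℂ] (ℂ ⊗[ℝ] V) where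
  toFun := LinearMap.rTensor V Complex.conjAe.toLinearMap
  map_add' := map_add _
  map_smul' c x := by
    induction x using TensorProduct.induction_on with
    | zero => simp
    | tmul a v => simp [TensorProduct.smul_tmul']
    | add x y hx hy => simp only [smul_add, map_add, hx, hy]

/-- The subspace `F^p` of a family, with the convention `F^p = 0` for `p > n`. -/
noncomputable def step {n : ℕ} (F : Family (ℂ ⊗[ℝ] V) n) (p : ℕ) : Submodule ℂ (ℂ ⊗[ℝ] V) :=
  if hp : p < n + 1 then F ⟨p, hp⟩ else ⊥

/-- The complex conjugate of a complex subspace of `ℂ ⊗ V`. -/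
noncomputable def conjSubspace (L : Submodule ℂ (ℂ ⊗[ℝ] V)) : Submodule ℂ (ℂ ⊗[ℝ] V) :=
  L.map conj

/-- `F` is a Hodge filtration of weight `n`: `Fⁿ ⊆ ⋯ ⊆ F⁰ = ℂ ⊗ V`, and `ℂ ⊗ V` is the direct sum
of `F^p` and the conjugate of `F^(n-p+1)` for each `p`. -/
structure IsHodgeFiltration {n : ℕ} (F : Family (ℂ ⊗[ℝ] V) n) : Prop where
  antitone : Antitone F
  zero_eq_top : F 0 = ⊤
  isCompl : ∀ p ≤ n + 1, IsCompl (step F p) (conjSubspace (step F (n + 1 - p)))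

/-- The Hodge component `H^{p,q} = F^p ∩ conj F^q`. -/
noncomputable def hodgePart {n : ℕ} (F : Family (ℂ ⊗[ℝ] V) n) (p q : ℕ) :
    Submodule ℂ (ℂ ⊗[ℝ] V) :=
  step F p ⊓ conjSubspace (step F q)

/-- `C` is the Weil operator of `F`: it acts on `H^{p,q}`, `p + q = n`, as `i^(p-q)`. -/
def IsWeilOperator {n : ℕ} (F : Family (ℂ ⊗[ℝ] V) n)
    (C : (ℂ ⊗[ℝ] V) →ₗ[ℂ] (ℂ ⊗[ℝ] V)) : Prop :=
  ∀ p q : ℕ, p + q = n → ∀ u ∈ hodgePart F p q, C u = Complex.I ^ ((p : ℤ) - (q : ℤ)) • u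

/-- `F` is a Hodge filtration of weight `n` polarized by `Q`, that is, one that satisfies the two
Hodge–Riemann bilinear relations. -/
structure IsPolarizedBy {n : ℕ} (F : Family (ℂ ⊗[ℝ] V) n) (Q : LinearMap.BilinForm ℝ V) :
    Prop where
  isHodge : IsHodgeFiltration F
  first : ∀ p ≤ n + 1, ∀ x ∈ step F p, ∀ y ∈ step F (n + 1 - p), Q.baseChange ℂ x y = 0
  second : ∃ C, IsWeilOperator F C ∧ ∀ u, u ≠ 0 →
    0 < (Q.baseChange ℂ (C u) (conj u)).re ∧ (Q.baseChange ℂ (C u) (conj u)).im = 0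

/-- The period domain `D`: all Hodge filtrations of weight `n` on `ℂ ⊗ V` polarized by `Q` with
Hodge numbers `h^{p,n-p} = h p`, as a subset of the product of Grassmannians. -/
def periodDomain (Q : LinearMap.BilinForm ℝ V) (n : ℕ) (h : ℕ → ℕ) :
    Set (Family (ℂ ⊗[ℝ] V) n) :=
  {F | IsPolarizedBy F Q ∧ ∀ p q : ℕ, p + q = n → Module.finrank ℂ (hodgePart F p q) = h p}

/-- The real vector `ζ` is of type `(p,q)` for `F`. -/
def IsOfType {n : ℕ} (F : Family (ℂ ⊗[ℝ] V) n) (ζ : V) (p q : ℕ) : Prop :=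
  (1 : ℂ) ⊗ₜ[ℝ] ζ ∈ hodgePart F p q

/-- The Noether–Lefschetz locus `D_ζ`: the points of the period domain of weight `2m` for which
`ζ` is of type `(m,m)`. -/
def noetherLefschetzLocus (Q : LinearMap.BilinForm ℝ V) (m : ℕ) (h : ℕ → ℕ) (ζ : V) :
    Set (Family (ℂ ⊗[ℝ] V) (2 * m)) :=
  {F | F ∈ periodDomain Q (2 * m) h ∧ IsOfType F ζ m m}

/-- The group `G_ℝ = Aut(V, Q)` of linear automorphisms of `V` that preserve `Q`. -/
def isometryGroup (Q : LinearMap.BilinForm ℝ V) : Subgroup (V ≃ₗ[ℝ] V) where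
  carrier := {g | ∀ x y, Q (g x) (g y) = Q x y}
  one_mem' := fun _ _ => rfl
  mul_mem' := fun {a b} ha hb x y => (ha (b x) (b y)).trans (hb x y)
  inv_mem' := fun {a} ha x y => by
    have hxy := ha (a⁻¹ x) (a⁻¹ y)
    have e : ∀ z, a (a⁻¹ z) = z := fun z => a.apply_symm_apply z
    rw [e, e] at hxy
    exact hxy.symm

/-- The group `G_ζ` of the elements of `G_ℝ` that fix `ζ` up to scaling. -/
def lineStabilizer (Q : LinearMap.BilinForm ℝ V) (ζ : V) : Subgroup (V ≃ₗ[ℝ] V) where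
  carrier := {g | g ∈ isometryGroup Q ∧ ∃ c : ℝˣ, g ζ = (c : ℝ) • ζ}
  one_mem' := ⟨one_mem _, 1, by simp⟩
  mul_mem' := fun {a b} ha hb => by
    obtain ⟨ha, c, hc⟩ := ha
    obtain ⟨hb, d, hd⟩ := hb
    refine ⟨mul_mem ha hb, d * c, ?_⟩
    rw [LinearEquiv.mul_apply, hd, map_smul, hc, smul_smul, Units.val_mul]
  inv_mem' := fun {a} ha => by
    obtain ⟨ha, c, hc⟩ := ha
    refine ⟨inv_mem ha, c⁻¹, ?_⟩
    have e : a⁻¹ (a ζ) = ζ := a.symm_apply_apply ζ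
    rw [hc, map_smul] at e
    calc a⁻¹ ζ = ((c⁻¹ : ℝˣ) : ℝ) • ((c : ℝ) • a⁻¹ ζ) := by
          rw [smul_smul, Units.inv_mul, one_smul]
      _ = _ := by rw [e]

/-- The complex-linear extension of `g` to `ℂ ⊗ V`. -/
noncomputable def complexify (g : V ≃ₗ[ℝ] V) : (ℂ ⊗[ℝ] V) →ₗ[ℂ] (ℂ ⊗[ℝ] V) :=
  LinearMap.baseChange ℂ (g : V →ₗ[ℝ] V)

/-- The point `g · F`: each subspace of the family is moved by the complex-linear extension
of `g`. -/
noncomputable def translate {n : ℕ} (g : V ≃ₗ[ℝ] V) (F : Family (ℂ ⊗[ℝ] V) n) :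
    Family (ℂ ⊗[ℝ] V) n :=
  F.map (complexify g)

/-- The orbit `Γ · F`. -/
def orbit {n : ℕ} (Γ : Subgroup (V ≃ₗ[ℝ] V)) (F : Family (ℂ ⊗[ℝ] V) n) :
    Set (Family (ℂ ⊗[ℝ] V) n) :=
  {x | ∃ g ∈ Γ, x = translate g F}

/-- `S` is homogeneous under `Γ`: the group `Γ` acts on `S`, the action is transitive, and it is
holomorphic (the action on points near `S` depends holomorphically on the point, and analytically
on the group element). -/
structure IsHomogeneousUnder [FiniteDimensional ℝ V] {n : ℕ} (Γ : Subgroup (V ≃ₗ[ℝ] V))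
    (S : Set (Family (ℂ ⊗[ℝ] V) n)) : Prop where
  nonempty : S.Nonempty
  mapsTo : ∀ g ∈ Γ, ∀ x ∈ S, translate g x ∈ S
  transitive : ∀ x ∈ S, ∀ y ∈ S, ∃ g ∈ Γ, translate g x = y
  holomorphic : ∀ g ∈ Γ, ∀ x ∈ S, ActsHolomorphicallyAt (complexify g) x

end HodgeStructures

end NoetherLefschetz

/-! Transitivity. At a point of `D_ζ` the space `ℂ ⊗ V` has a basis (`IsHodgeBasis`) consisting of
vectors of the `H^{p,q}` with `p > m`, their conjugates, and real vectors of `H^{m,m}`. It is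
orthonormal up to the signs `(-1)^(p-m)` for the hermitian form `Q (u, conj v)`, and its first real
vector is `ζ / √(Q ζ ζ)`. The linear map that matches two such bases, taken at two points of `D_ζ`,
commutes with conjugation, hence is the complexification of a real automorphism. It preserves `Q`,
carries one filtration to the other, and fixes `ζ` because the factor `√(Q ζ ζ)` does not depend on
the point (`exists_isHodgeBasis`, `exists_translate_eq`). Conversely `G_ζ` preserves every condition
that defines `D_ζ`.

Submanifold. Once one point of `D` is known, membership in `D` can be tested on the filtration alone
(`IsPolarizedFlag`, `mem_periodDomain`): inclusions, dimensions, the first Hodge–Riemann relation,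
and positivity on the orthogonal complement of `F^{p+1}` in `F^p`. In the graph chart of a Hodge
basis the dimensions are automatic and positivity persists near the origin (`isPositive_of_graph`),
so `D` is cut out by equations: quadratic ones for `F^{p+1} ⊆ F^p`, and `Q (v_i, v_k) = 0` for the
leading vectors `v_i`, which span every member of the chain. Since `F^m` is the orthogonal
complement of `F^{m+1}`, the locus `D_ζ` is cut out in `D` by `Q (v_i, ζ) = 0` for `deg i > m`. That
is one vanishing coordinate for each basis vector of `F^{m+1}`, which gives the codimension. All
these equations have independent linear parts at the origin (`exists_linearEquations_eq`), and
independence is an open condition.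

Holomorphy. Applying a matrix to a graph and reducing the result to a graph again is rational in all
entries (`actsHolomorphicallyAt`). -/

namespace NoetherLefschetz

/-! ### Conjugation, real parts and the hermitian form on the complexification. -/

section Conjugation

variable {V : Type*} [AddCommGroup V] [Module ℝ V]

@[simp] lemma conj_tmul (a : ℂ) (v : V) : conj (a ⊗ₜ[ℝ] v) = (starRingEnd ℂ a) ⊗ₜ[ℝ] v := by
  simp [conj]

@[simp] lemma conj_conj (u : ℂ ⊗[ℝ] V) : conj (conj u) = u := by
  induction u using TensorProduct.induction_on with
  | zero => simp
  | tmul a v => simp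
  | add x y hx hy => simp [hx, hy]

lemma conj_injective : Function.Injective (conj : (ℂ ⊗[ℝ] V) → ℂ ⊗[ℝ] V) := fun x y hxy => by
  rw [← conj_conj x, hxy, conj_conj]

lemma mem_conjSubspace {L : Submodule ℂ (ℂ ⊗[ℝ] V)} {x : ℂ ⊗[ℝ] V} :
    x ∈ conjSubspace L ↔ conj x ∈ L := by
  constructor
  · rintro ⟨y, hy, rfl⟩
    simpa using hy
  · intro hx
    exact ⟨conj x, hx, conj_conj x⟩

lemma finrank_conjSubspace (L : Submodule ℂ (ℂ ⊗[ℝ] V)) :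
    Module.finrank ℂ (conjSubspace L) = Module.finrank ℂ L := by
  let j : L ≃+ conjSubspace L :=
    { toFun := fun x => ⟨conj (x : ℂ ⊗[ℝ] V), ⟨x, x.2, rfl⟩⟩
      invFun := fun x => ⟨conj (x : ℂ ⊗[ℝ] V), mem_conjSubspace.1 x.2⟩
      left_inv := fun x => by simp
      right_inv := fun x => by simp
      map_add' := fun x y => by ext1; simp }
  have := rank_eq_of_equiv_equiv (starRingEnd ℂ) j (starRingAut (R := ℂ)).bijective
    (fun r x => by ext1; simp [j])
  simp [Module.finrank, this]

/-- The real part of a vector of the complexification. -/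
noncomputable def rePart : (ℂ ⊗[ℝ] V) →ₗ[ℝ] V :=
  (TensorProduct.lid ℝ V).toLinearMap ∘ₗ LinearMap.rTensor V Complex.reLm

@[simp] lemma rePart_tmul (a : ℂ) (v : V) : rePart (a ⊗ₜ[ℝ] v) = a.re • v := by
  simp [rePart]

lemma add_conj (u : ℂ ⊗[ℝ] V) : u + conj u = (2 : ℂ) • ((1 : ℂ) ⊗ₜ[ℝ] rePart u) := by
  induction u using TensorProduct.induction_on with
  | zero => simp
  | tmul a v =>
    rw [conj_tmul, rePart_tmul, ← TensorProduct.add_tmul, Complex.add_conj,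
      TensorProduct.tmul_smul, TensorProduct.smul_tmul', TensorProduct.smul_tmul']
    congr 1
    simp [mul_comm]
  | add x y hx hy =>
    rw [map_add, map_add, TensorProduct.tmul_add, smul_add, ← hx, ← hy]
    abel

lemma eq_tmul_of_conj_eq {u : ℂ ⊗[ℝ] V} (hu : conj u = u) : u = (1 : ℂ) ⊗ₜ[ℝ] rePart u := by
  have h := add_conj u
  rw [hu, ← two_smul ℂ u] at h
  exact smul_right_injective _ (two_ne_zero' ℂ) h

/-- Every vector is `a + i b` with `a`, `b` real. -/
lemma eq_re_add_im (u : ℂ ⊗[ℝ] V) :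
    u = (1 : ℂ) ⊗ₜ[ℝ] rePart u + Complex.I • ((1 : ℂ) ⊗ₜ[ℝ] rePart (-Complex.I • u)) := by
  have h1 := add_conj u
  have h2 := add_conj (-Complex.I • u)
  have h3 : conj (-Complex.I • u) = Complex.I • conj u := by
    rw [LinearMap.map_smulₛₗ]; simp
  rw [h3] at h2
  apply smul_right_injective _ (two_ne_zero' ℂ)
  show (2 : ℂ) • u = (2 : ℂ) • _
  rw [smul_add, ← h1, smul_comm, ← h2, smul_add, smul_smul, smul_smul, Complex.I_mul_I]
  simp only [mul_neg, Complex.I_mul_I, neg_neg, one_smul, neg_smul, two_smul]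
  abel

/-- The sesquilinear form `(u, v) ↦ Q (u, conj v)`. -/
noncomputable def herm (Q : LinearMap.BilinForm ℝ V) :
    (ℂ ⊗[ℝ] V) →ₗ[ℂ] (ℂ ⊗[ℝ] V) →ₛₗ[starRingEnd ℂ] ℂ :=
  LinearMap.mk₂'ₛₗ (RingHom.id ℂ) (starRingEnd ℂ) (fun u v => Q.baseChange ℂ u (conj v))
    (by simp) (by simp) (by simp) (by simp)

lemma herm_apply (Q : LinearMap.BilinForm ℝ V) (u v : ℂ ⊗[ℝ] V) :
    herm Q u v = Q.baseChange ℂ u (conj v) := rfl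

lemma baseChange_eq_herm (Q : LinearMap.BilinForm ℝ V) (u v : ℂ ⊗[ℝ] V) :
    Q.baseChange ℂ u v = herm Q u (conj v) := by
  rw [herm_apply, conj_conj]

lemma baseChange_conj_conj (Q : LinearMap.BilinForm ℝ V) (u v : ℂ ⊗[ℝ] V) :
    Q.baseChange ℂ (conj u) (conj v) = starRingEnd ℂ (Q.baseChange ℂ u v) := by
  induction u using TensorProduct.induction_on with
  | zero => simp
  | add x y hx hy => simp [hx, hy]
  | tmul a x =>
    induction v using TensorProduct.induction_on with
    | zero => simp
    | add x y hx hy => simp only [map_add, hx, hy]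
    | tmul b y => simp

variable {Q : LinearMap.BilinForm ℝ V}

lemma baseChange_comm (hs : Q.IsSymm) (u v : ℂ ⊗[ℝ] V) :
    Q.baseChange ℂ u v = Q.baseChange ℂ v u := by
  induction u using TensorProduct.induction_on with
  | zero => simp
  | add x y hx hy => simp [hx, hy]
  | tmul a x =>
    induction v using TensorProduct.induction_on with
    | zero => simp
    | add x y hx hy => simp only [map_add, LinearMap.add_apply, hx, hy]
    | tmul b y => simp [mul_comm a b, hs.eq x y]

lemma conj_herm (hs : Q.IsSymm) (u v : ℂ ⊗[ℝ] V) :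
    starRingEnd ℂ (herm Q u v) = herm Q v u := by
  rw [herm_apply, ← baseChange_conj_conj, conj_conj, baseChange_comm hs, herm_apply]

lemma herm_eq_zero_comm (hs : Q.IsSymm) {u v : ℂ ⊗[ℝ] V} : herm Q u v = 0 ↔ herm Q v u = 0 := by
  rw [← conj_herm hs, map_eq_zero]

end Conjugation

/-! ### Filtration steps and their Hodge complements. -/

section Steps

variable {V : Type*} [AddCommGroup V] [Module ℝ V] {n : ℕ} {F : Family (ℂ ⊗[ℝ] V) n}

lemma step_of_lt {p : ℕ} (hp : p < n + 1) : step F p = F ⟨p, hp⟩ := dif_pos hp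

lemma step_of_gt {p : ℕ} (hp : n < p) : step F p = ⊥ := dif_neg (by omega)

lemma step_antitone (hF : Antitone F) : Antitone (step F) := by
  intro p q hpq
  by_cases hq : q < n + 1
  · rw [step_of_lt hq, step_of_lt (by omega : p < n + 1)]
    exact hF (by simpa using hpq)
  · rw [step_of_gt (by omega)]
    exact bot_le

lemma step_zero (hF : F 0 = ⊤) : step F 0 = ⊤ := by
  rw [step_of_lt (Nat.succ_pos n)]; exact hF

/-- The Hodge component `H^{p,n-p}` is a complement of `F^{p+1}` in `F^p`. -/
lemma IsHodgeFiltration.sup_hodgePart (hF : IsHodgeFiltration F) {p : ℕ} (hp : p ≤ n) :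
    step F (p + 1) ⊔ hodgePart F p (n - p) = step F p := by
  have hc := hF.isCompl (p + 1) (by omega)
  rw [show n + 1 - (p + 1) = n - p by omega] at hc
  rw [hodgePart, inf_comm, ← sup_inf_assoc_of_le _ (step_antitone hF.antitone (Nat.le_succ p)),
    hc.sup_eq_top, top_inf_eq]

lemma IsHodgeFiltration.disjoint_hodgePart (hF : IsHodgeFiltration F) {p : ℕ} (hp : p ≤ n) :
    Disjoint (step F (p + 1)) (hodgePart F p (n - p)) := by
  have hc := hF.isCompl (p + 1) (by omega)
  rw [show n + 1 - (p + 1) = n - p by omega] at hc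
  exact hc.disjoint.mono_right inf_le_right

lemma IsHodgeFiltration.finrank_step_succ [FiniteDimensional ℝ V] (hF : IsHodgeFiltration F)
    {p : ℕ} (hp : p ≤ n) : Module.finrank ℂ (step F p) =
      Module.finrank ℂ (hodgePart F p (n - p)) + Module.finrank ℂ (step F (p + 1)) := by
  have h := Submodule.finrank_sup_add_finrank_inf_eq (step F (p + 1)) (hodgePart F p (n - p))
  rw [hF.sup_hodgePart hp, (hF.disjoint_hodgePart hp).eq_bot, finrank_bot] at h
  omega

lemma step_induction {P : ℕ → Prop} (hgt : ∀ p, n < p → P p) (hle : ∀ p ≤ n, P (p + 1) → P p)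
    (p : ℕ) : P p := by
  by_cases hp : n < p
  · exact hgt p hp
  · exact Nat.decreasingInduction (motive := fun k _ => P k) (fun k hk h => hle k (by omega) h)
      (hgt (n + 1) (by omega)) (by omega : p ≤ n + 1)

end Steps

/-! ### The period domain described by filtrations alone. -/

section Criterion

variable {V : Type*} [AddCommGroup V] [Module ℝ V] {Q : LinearMap.BilinForm ℝ V}

/-- A vector of `F^p` which is orthogonal to `conj F^p` vanishes. -/
lemma IsPolarizedBy.eq_zero_of_herm_eq_zero {n : ℕ} {F : Family (ℂ ⊗[ℝ] V) n}
    (hF : IsPolarizedBy F Q) {p : ℕ} (hp : p ≤ n + 1) {b : ℂ ⊗[ℝ] V}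
    (hb : b ∈ step F p) (h : ∀ v ∈ step F p, herm Q v b = 0) : b = 0 := by
  by_contra hb0
  obtain ⟨C, -, hC⟩ := hF.second
  have key : ∀ v, herm Q v b = 0 := by
    intro v
    -- The first relation makes `b` orthogonal to `conj F^{n+1-p}` as well, hence to everything,
    -- which contradicts `Q (C b, conj b) > 0`.
    have hv : v ∈ step F p ⊔ conjSubspace (step F (n + 1 - p)) := by
      rw [(hF.isHodge.isCompl p hp).sup_eq_top]; trivial
    obtain ⟨x, hx, y, hy, rfl⟩ := Submodule.mem_sup.1 hv
    have hyb : Q.baseChange ℂ (conj y) b = 0 := by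
      refine hF.first (n + 1 - p) (by omega) _ (mem_conjSubspace.1 hy) _ ?_
      rwa [show n + 1 - (n + 1 - p) = p by omega]
    have : herm Q y b = 0 := by
      rw [herm_apply, ← conj_conj y, baseChange_conj_conj, hyb, map_zero]
    rw [map_add, LinearMap.add_apply, h x hx, this, add_zero]
  have := (hC b hb0).1
  rw [← herm_apply, key] at this
  simp at this

/-- The orthogonal complement of `F^p` is contained in `F^{n+1-p}`. -/
lemma IsPolarizedBy.mem_step_of_orthogonal {n : ℕ} {F : Family (ℂ ⊗[ℝ] V) n}
    (hF : IsPolarizedBy F Q) {p : ℕ} (hp : p ≤ n + 1) {y : ℂ ⊗[ℝ] V}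
    (h : ∀ v ∈ step F p, Q.baseChange ℂ v y = 0) : y ∈ step F (n + 1 - p) := by
  have hy : y ∈ step F (n + 1 - p) ⊔ conjSubspace (step F p) := by
    have := (hF.isHodge.isCompl (n + 1 - p) (by omega)).sup_eq_top
    rw [show n + 1 - (n + 1 - p) = p by omega] at this
    rw [this]; trivial
  obtain ⟨a, ha, b, hb, rfl⟩ := Submodule.mem_sup.1 hy
  have hb0 : conj b = 0 := by
    refine hF.eq_zero_of_herm_eq_zero hp (mem_conjSubspace.1 hb) fun v hv => ?_
    have h1 := h v hv
    rw [map_add, hF.first p hp v hv a ha, zero_add] at h1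
    rwa [herm_apply, conj_conj]
  have : b = 0 := conj_injective (by rw [hb0, map_zero])
  rwa [this, add_zero]

/-- The second Hodge–Riemann relation in terms of the filtration: on the orthogonal complement of
`F^{p+1}` in `F^p` the hermitian form is definite of sign `(-1)^(p-m)`. -/
def IsPositive (Q : LinearMap.BilinForm ℝ V) {m : ℕ} (F : Family (ℂ ⊗[ℝ] V) (2 * m)) : Prop :=
  ∀ p ≤ 2 * m, ∀ u ∈ step F p, (∀ v ∈ step F (p + 1), herm Q v u = 0) → u ≠ 0 →
    0 < (-1 : ℝ) ^ (p + m) * (herm Q u u).re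

lemma I_zpow_sub {m p : ℕ} (hp : p ≤ 2 * m) :
    Complex.I ^ ((p : ℤ) - ((2 * m - p : ℕ) : ℤ)) = (((-1 : ℝ) ^ (p + m) : ℝ) : ℂ) := by
  have e : (p : ℤ) - ((2 * m - p : ℕ) : ℤ) = 2 * ((p : ℤ) - m) := by
    push_cast [Nat.cast_sub hp]; ring
  rw [e, zpow_mul]
  have : Complex.I ^ (2 : ℤ) = -1 := by
    exact_mod_cast Complex.I_sq
  rw [this]
  push_cast
  rw [zpow_sub₀ (by norm_num), div_eq_mul_inv, ← inv_zpow, pow_add]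
  norm_num

/-- Write `u = a + b` with `a ∈ F^{p+1}` and `b ∈ H^{p,q}`. The first relation makes `b` orthogonal
to `F^{p+1}`, so `a` is too, hence `a = 0`. On `H^{p,q}` the Weil operator is the scalar
`(-1)^(p-m)`. -/
lemma IsPolarizedBy.isPositive {m : ℕ} {F : Family (ℂ ⊗[ℝ] V) (2 * m)}
    (hF : IsPolarizedBy F Q) : IsPositive Q F := by
  intro p hp u hu horth hu0
  rw [← hF.isHodge.sup_hodgePart hp] at hu
  obtain ⟨a, ha, b, hb, rfl⟩ := Submodule.mem_sup.1 hu
  have hvb : ∀ v ∈ step F (p + 1), herm Q v b = 0 := fun v hv =>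
    hF.first (p + 1) (by omega) v hv _ (by
      rw [show 2 * m + 1 - (p + 1) = 2 * m - p by omega]
      exact mem_conjSubspace.1 hb.2)
  have ha0 : a = 0 := by
    refine hF.eq_zero_of_herm_eq_zero (by omega) ha fun v hv => ?_
    have := horth v hv
    rwa [map_add, hvb v hv, add_zero] at this
  subst ha0
  rw [zero_add] at hu0 ⊢
  obtain ⟨C, hC, hpos⟩ := hF.second
  have h1 := (hpos b hu0).1
  rw [hC p (2 * m - p) (by omega) b hb, I_zpow_sub hp, ← herm_apply, map_smul,
    LinearMap.smul_apply, smul_eq_mul, Complex.re_ofReal_mul] at h1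
  exact h1

lemma finrank_step [FiniteDimensional ℝ V] {n : ℕ} {h : ℕ → ℕ} {F : Family (ℂ ⊗[ℝ] V) n}
    (hF : F ∈ periodDomain Q n h) (p : ℕ) :
    Module.finrank ℂ (step F p) = ∑ r ∈ Finset.Ico p (n + 1), h r := by
  induction p using step_induction (n := n) with
  | hgt p hp => rw [step_of_gt hp, Finset.Ico_eq_empty (by omega)]; simp
  | hle p hp ih =>
    rw [hF.1.isHodge.finrank_step_succ hp, ih, hF.2 p (n - p) (by omega),
      ← Finset.sum_eq_sum_Ico_succ_bot (by omega)]

/-- The conditions which characterise the points of the period domain among filtrations, without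
reference to the Hodge decomposition. -/
structure IsPolarizedFlag (Q : LinearMap.BilinForm ℝ V) {m : ℕ} (h : ℕ → ℕ)
    (F : Family (ℂ ⊗[ℝ] V) (2 * m)) : Prop where
  antitone : Antitone F
  zero_eq_top : F 0 = ⊤
  first : ∀ p ≤ 2 * m + 1, ∀ x ∈ step F p, ∀ y ∈ step F (2 * m + 1 - p), Q.baseChange ℂ x y = 0
  finrank : ∀ p, Module.finrank ℂ (step F p) = ∑ r ∈ Finset.Ico p (2 * m + 1), h r
  positive : IsPositive Q F

lemma isPolarizedFlag_of_mem [FiniteDimensional ℝ V] {m : ℕ} {h : ℕ → ℕ}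
    {F : Family (ℂ ⊗[ℝ] V) (2 * m)} (hF : F ∈ periodDomain Q (2 * m) h) :
    IsPolarizedFlag Q h F :=
  ⟨hF.1.isHodge.antitone, hF.1.isHodge.zero_eq_top, hF.1.first, finrank_step hF, hF.1.isPositive⟩

lemma step_sub_mem {n : ℕ} {F : Family (ℂ ⊗[ℝ] V) n} (hF : Antitone F) {p r : ℕ} (hpr : r < p)
    {u : ℂ ⊗[ℝ] V} (hu : u ∈ step F (n - r)) : u ∈ step F (n + 1 - p) :=
  step_antitone hF (by omega) hu

namespace IsPolarizedFlag

variable {m : ℕ} {h : ℕ → ℕ} {F : Family (ℂ ⊗[ℝ] V) (2 * m)}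

lemma eq_zero_of_mem (hF : IsPolarizedFlag Q h F) {p : ℕ} {u : ℂ ⊗[ℝ] V} (hu : u ∈ step F p)
    (horth : ∀ v ∈ step F p, herm Q v u = 0) : u = 0 := by
  by_contra hu0
  by_cases hp : p ≤ 2 * m
  · have := hF.positive p hp u hu
      (fun v hv => horth v (step_antitone hF.antitone (Nat.le_succ p) hv)) hu0
    rw [horth u hu] at this
    simp at this
  · rw [step_of_gt (by omega)] at hu
    exact hu0 (by simpa using hu)

/-- The dimensions depend only on `h`, so the identity can be read off at the known point `F₀`,
where the Hodge decomposition is available. -/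
lemma finrank_add [FiniteDimensional ℝ V] (hF : IsPolarizedFlag Q h F)
    {F₀ : Family (ℂ ⊗[ℝ] V) (2 * m)} (hF₀ : F₀ ∈ periodDomain Q (2 * m) h) {p : ℕ}
    (hp : p ≤ 2 * m + 1) :
    Module.finrank ℂ (step F p) + Module.finrank ℂ (step F (2 * m + 1 - p)) =
      Module.finrank ℂ (ℂ ⊗[ℝ] V) := by
  rw [hF.finrank, hF.finrank, ← finrank_step hF₀, ← finrank_step hF₀, ← finrank_conjSubspace
    (step F₀ (2 * m + 1 - p))]
  exact Submodule.finrank_add_eq_of_isCompl (hF₀.1.isHodge.isCompl p hp)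

/-- A vector of `F^p ∩ conj F^{n+1-p}` is orthogonal to `F^p` by the first relation, hence zero by
positivity; the dimensions then force a direct sum. -/
lemma isHodgeFiltration [FiniteDimensional ℝ V] (hF : IsPolarizedFlag Q h F)
    {F₀ : Family (ℂ ⊗[ℝ] V) (2 * m)} (hF₀ : F₀ ∈ periodDomain Q (2 * m) h) :
    IsHodgeFiltration F := by
  refine ⟨hF.antitone, hF.zero_eq_top, fun p hp => ?_⟩
  have hd : step F p ⊓ conjSubspace (step F (2 * m + 1 - p)) = ⊥ := by
    rw [Submodule.eq_bot_iff]
    rintro u ⟨hu, hu'⟩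
    exact hF.eq_zero_of_mem hu fun v hv => hF.first p hp v hv _ (mem_conjSubspace.1 hu')
  refine IsCompl.of_eq hd ?_
  apply Submodule.eq_top_of_finrank_eq
  have h1 := Submodule.finrank_sup_add_finrank_inf_eq (step F p)
    (conjSubspace (step F (2 * m + 1 - p)))
  rw [hd, finrank_bot, finrank_conjSubspace, hF.finrank_add hF₀ hp] at h1
  simpa using h1

lemma finrank_hodgePart [FiniteDimensional ℝ V] (hF : IsPolarizedFlag Q h F)
    {F₀ : Family (ℂ ⊗[ℝ] V) (2 * m)} (hF₀ : F₀ ∈ periodDomain Q (2 * m) h) {p : ℕ}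
    (hp : p ≤ 2 * m) : Module.finrank ℂ (hodgePart F p (2 * m - p)) = h p := by
  have h1 := (hF.isHodgeFiltration hF₀).finrank_step_succ hp
  rw [hF.finrank, hF.finrank, Finset.sum_eq_sum_Ico_succ_bot (by omega)] at h1
  omega

/-- Different Hodge components are orthogonal. -/
lemma herm_hodgePart (hF : IsPolarizedFlag Q h F) (hs : Q.IsSymm) {p r : ℕ} (hp : p ≤ 2 * m)
    (hr : r ≤ 2 * m) (hpr : p ≠ r) {u v : ℂ ⊗[ℝ] V} (hu : u ∈ hodgePart F p (2 * m - p))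
    (hv : v ∈ hodgePart F r (2 * m - r)) : herm Q u v = 0 := by
  rcases lt_or_gt_of_ne hpr with hlt | hlt
  · rw [herm_eq_zero_comm hs]
    exact hF.first r (by omega) _ hv.1 _
      (step_sub_mem hF.antitone hlt (mem_conjSubspace.1 hu.2))
  · exact hF.first p (by omega) _ hu.1 _
      (step_sub_mem hF.antitone hlt (mem_conjSubspace.1 hv.2))

/-- The hermitian form is definite on the Hodge components. -/
lemma herm_self_pos (hF : IsPolarizedFlag Q h F) {p : ℕ} (hp : p ≤ 2 * m)
    {u : ℂ ⊗[ℝ] V} (hu : u ∈ hodgePart F p (2 * m - p)) (hu0 : u ≠ 0) :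
    0 < (-1 : ℝ) ^ (p + m) * (herm Q u u).re := by
  refine hF.positive p hp u hu.1 (fun v hv => ?_) hu0
  exact hF.first (p + 1) (by omega) v hv _ (by
      rw [show 2 * m + 1 - (p + 1) = 2 * m - p by omega]
      exact mem_conjSubspace.1 hu.2)

end IsPolarizedFlag

end Criterion

/-! ### Orthonormal bases with a prescribed first direction. -/

section Orthonormal

/-- An orthonormal basis whose first vector is proportional to a given vector. -/
lemma exists_orthonormalBasis_head {𝕜 E : Type*} [RCLike 𝕜] [NormedAddCommGroup E]
    [InnerProductSpace 𝕜 E] [FiniteDimensional 𝕜 E] {k : ℕ} (hk : Module.finrank 𝕜 E = k) (v : E) :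
    ∃ b : OrthonormalBasis (Fin k) 𝕜 E, ∀ i : Fin k, i.val = 0 → v = (‖v‖ : 𝕜) • b i := by
  by_cases hv : v = 0
  · subst hv
    exact ⟨(stdOrthonormalBasis 𝕜 E).reindex (finCongr hk), fun i _ => by simp⟩
  · have hv' : (‖v‖ : 𝕜) ≠ 0 := by simpa using hv
    obtain ⟨b, hb⟩ := Orthonormal.exists_orthonormalBasis_extension_of_card_eq (𝕜 := 𝕜)
      (ι := Fin k) (by simpa using hk) (v := fun _ => (‖v‖ : 𝕜)⁻¹ • v)
      (s := {i : Fin k | i.val = 0}) (by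
        constructor
        · intro i
          simp [norm_smul, hv]
        · rintro ⟨i, hi⟩ ⟨j, hj⟩ hij
          exact absurd (Subtype.ext (Fin.ext ((show i.val = 0 from hi).trans
            (show j.val = 0 from hj).symm))) hij)
    exact ⟨b, fun i hi => by rw [hb i hi, smul_smul, mul_inv_cancel₀ hv', one_smul]⟩

/-- A positive definite hermitian form has an orthonormal basis, whose first vector can be chosen
proportional to a given vector. -/
lemma exists_orthonormal_of_form {𝕜 L : Type*} [RCLike 𝕜] [AddCommGroup L] [Module 𝕜 L]
    [FiniteDimensional 𝕜 L] (B : L → L → 𝕜) (hadd : ∀ x y z, B (x + y) z = B x z + B y z)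
    (hsmul : ∀ (c : 𝕜) x y, B (c • x) y = c * B x y)
    (hsymm : ∀ x y, starRingEnd 𝕜 (B x y) = B y x) (hpos : ∀ x, x ≠ 0 → 0 < RCLike.re (B x x))
    {k : ℕ} (hk : Module.finrank 𝕜 L = k) (v : L) :
    ∃ b : Fin k → L, (∀ i j, B (b i) (b j) = if i = j then 1 else 0) ∧
      ∀ i, i.val = 0 → v = ((√(RCLike.re (B v v)) : ℝ) : 𝕜) • b i := by
  have hzero : ∀ y, B 0 y = 0 := fun y => by simpa using hsmul 0 0 y
  have hswap : ∀ x y z, B x (y + z) = B x y + B x z := fun x y z => by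
    rw [← hsymm, hadd, map_add, hsymm, hsymm]
  let core : InnerProductSpace.Core 𝕜 L :=
    -- `inner` is conjugate-linear in its first argument while `B` is linear there, hence the
    -- exchange.
    { inner := fun x y => B y x
      conj_inner_symm := fun x y => hsymm x y
      re_inner_nonneg := fun x => by
        by_cases hx : x = 0
        · subst hx; rw [hzero]; simp
        · exact (hpos x hx).le
      add_left := fun x y z => hswap z x y
      smul_left := fun x y r => by
        show B y (r • x) = _
        rw [← hsymm, hsmul, map_mul, hsymm]
      definite := fun x hx => by
        by_contra h0
        have := hpos x h0
        rw [show B x x = 0 from hx] at this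
        simp at this }
  let _ : NormedAddCommGroup L := core.toNormedAddCommGroup
  let _ : InnerProductSpace 𝕜 L := InnerProductSpace.ofCore core.toCore
  obtain ⟨b, hb⟩ := exists_orthonormalBasis_head hk v
  refine ⟨b, fun i j => ?_, fun i hi => ?_⟩
  · have := orthonormal_iff_ite.1 b.orthonormal j i
    rw [show B (b i) (b j) = inner 𝕜 (b j) (b i) from rfl, this]
    simp only [eq_comm]
  · have h1 : ‖v‖ = √(RCLike.re (B v v)) := rfl
    rw [← h1]
    exact hb i hi

end Orthonormal

/-! ### Bases adapted to a Hodge decomposition and to conjugation. -/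

section HodgeBasis

variable {V : Type*} [AddCommGroup V] [Module ℝ V] {Q : LinearMap.BilinForm ℝ V} {m : ℕ}
  {h : ℕ → ℕ} {F : Family (ℂ ⊗[ℝ] V) (2 * m)}

lemma linearIndependent_of_herm {ι : Type*} {b : ι → ℂ ⊗[ℝ] V} {s : ι → ℂ} (hs : ∀ i, s i ≠ 0)
    (hb : ∀ i, herm Q (b i) (b i) = s i) (hb' : ∀ i j, i ≠ j → herm Q (b i) (b j) = 0) :
    LinearIndependent ℂ b := by
  classical
  rw [linearIndependent_iff']
  intro t c hc i hi
  have h1 : herm Q (∑ j ∈ t, c j • b j) (b i) = 0 := by rw [hc]; simp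
  rw [map_sum, LinearMap.sum_apply, Finset.sum_eq_single i] at h1
  · simpa [hb, hs] using h1
  · intro j _ hj
    simp [hb' j i hj]
  · exact fun h => absurd hi h

variable (m h) in
/-- The index set of a basis adapted to a Hodge decomposition of weight `2m` with Hodge numbers
`h`: basis vectors of `H^{p,q}` for `p > m`, their conjugates, and basis vectors of `H^{m,m}`. -/
abbrev HodgeIndex : Type :=
  ((Σ r : Fin m, Fin (h (m + 1 + r))) ⊕ (Σ r : Fin m, Fin (h (m + 1 + r)))) ⊕ Fin (h m)

/-- The basis vector with index `i` lies in `H^{p,2m-p}`, `p = deg i`. -/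
def deg : HodgeIndex m h → ℕ :=
  Sum.elim (Sum.elim (fun x => m + 1 + x.1) (fun x => m - 1 - x.1)) (fun _ => m)

/-- The action of complex conjugation on the indices. -/
def swap : HodgeIndex m h → HodgeIndex m h := Sum.map Sum.swap id

@[simp] lemma swap_swap (i : HodgeIndex m h) : swap (swap i) = i := by
  rcases i with (i | i) | i <;> rfl

lemma deg_swap (i : HodgeIndex m h) : deg (swap i) = 2 * m - deg i := by
  rcases i with (⟨⟨r, hr⟩, s⟩ | ⟨⟨r, hr⟩, s⟩) | i <;> simp only [deg, swap, Sum.map_inl, Sum.map_inr,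
    Sum.swap_inl, Sum.swap_inr, Sum.elim_inl, Sum.elim_inr, id_eq] <;> omega

lemma deg_le (i : HodgeIndex m h) : deg i ≤ 2 * m := by
  rcases i with (⟨⟨r, hr⟩, s⟩ | ⟨⟨r, hr⟩, s⟩) | i <;> simp only [deg,
    Sum.elim_inl, Sum.elim_inr] <;> omega

/-- The sign of the hermitian form on `H^{p,2m-p}`, `p = deg i`. -/
def sgn (i : HodgeIndex m h) : ℝ := (-1) ^ (deg i + m)

lemma sgn_mul_self (i : HodgeIndex m h) : sgn i * sgn i = 1 := by
  rw [sgn, ← mul_pow]; norm_num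

lemma sgn_ne_zero (i : HodgeIndex m h) : sgn i ≠ 0 := fun h0 => by
  simpa [h0] using sgn_mul_self i

lemma sgn_swap (i : HodgeIndex m h) : sgn (swap i) = sgn i := by
  rw [sgn, sgn, deg_swap]
  apply mul_left_cancel₀ (sgn_ne_zero i)
  rw [sgn, ← pow_add, ← pow_add, Even.neg_one_pow, Even.neg_one_pow]
  · exact ⟨deg i + m, by ring⟩
  · have := deg_le i
    exact ⟨2 * m, by omega⟩

/-- A basis of `ℂ ⊗ V` adapted to the Hodge decomposition, compatible with conjugation, and
orthonormal up to sign. -/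
structure IsHodgeBasis (Q : LinearMap.BilinForm ℝ V) (F : Family (ℂ ⊗[ℝ] V) (2 * m))
    (e : Module.Basis (HodgeIndex m h) ℂ (ℂ ⊗[ℝ] V)) : Prop where
  mem : ∀ i, e i ∈ hodgePart F (deg i) (2 * m - deg i)
  conj_apply : ∀ i, conj (e i) = e (swap i)
  herm_apply : ∀ i j, herm Q (e i) (e j) = if i = j then (sgn i : ℂ) else 0

lemma conj_mem_hodgePart {p q : ℕ} {u : ℂ ⊗[ℝ] V} (hu : u ∈ hodgePart F p q) :
    conj u ∈ hodgePart F q p :=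
  ⟨mem_conjSubspace.1 hu.2, mem_conjSubspace.2 (by simpa using hu.1)⟩

lemma finrank_hodgePart_comm (p q : ℕ) :
    Module.finrank ℂ (hodgePart F p q) = Module.finrank ℂ (hodgePart F q p) := by
  have : hodgePart F q p = conjSubspace (hodgePart F p q) := by
    ext u
    rw [mem_conjSubspace]
    exact ⟨conj_mem_hodgePart, fun hu => by simpa using conj_mem_hodgePart hu⟩
  rw [this, finrank_conjSubspace]

/-- The real vectors of type `(m,m)`. -/
noncomputable def realHodgePart (F : Family (ℂ ⊗[ℝ] V) (2 * m)) : Submodule ℝ V :=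
  ((hodgePart F m m).restrictScalars ℝ).comap (TensorProduct.mk ℝ ℂ V 1)

lemma mem_realHodgePart {v : V} : v ∈ realHodgePart F ↔ (1 : ℂ) ⊗ₜ[ℝ] v ∈ hodgePart F m m :=
  Iff.rfl

lemma mem_realHodgePart_iff {v : V} : v ∈ realHodgePart F ↔ (1 : ℂ) ⊗ₜ[ℝ] v ∈ step F m := by
  rw [mem_realHodgePart]
  refine ⟨fun hv => hv.1, fun hv => ⟨hv, mem_conjSubspace.2 ?_⟩⟩
  simpa using hv

lemma rePart_mem_realHodgePart {u : ℂ ⊗[ℝ] V} (hu : u ∈ hodgePart F m m) :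
    rePart u ∈ realHodgePart F := by
  rw [mem_realHodgePart]
  have h1 : (2 : ℂ) • ((1 : ℂ) ⊗ₜ[ℝ] rePart u) ∈ hodgePart F m m := by
    rw [← add_conj]
    exact add_mem hu (conj_mem_hodgePart hu)
  exact (Submodule.smul_mem_iff _ two_ne_zero).1 h1

/-- `H^{m,m}` is stable under conjugation, so it contains the real and imaginary parts of its
vectors and is the complexification of its real vectors. -/
lemma finrank_realHodgePart [FiniteDimensional ℝ V] :
    Module.finrank ℝ (realHodgePart F) = Module.finrank ℂ (hodgePart F m m) := by
  have hinj : Function.Injective (LinearMap.baseChange ℂ (realHodgePart F).subtype) :=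
    Module.Flat.lTensor_preserves_injective_linearMap (M := ℂ) _ (Submodule.subtype_injective _)
  rw [← Module.finrank_baseChange (R := ℂ), ← LinearMap.finrank_range_of_inj hinj]
  have : LinearMap.range (LinearMap.baseChange ℂ (realHodgePart F).subtype) = hodgePart F m m := by
    apply le_antisymm
    · rintro _ ⟨x, rfl⟩
      induction x using TensorProduct.induction_on with
      | zero => simp
      | add x y hx hy => rw [map_add]; exact add_mem hx hy
      | tmul a v =>
        have := Submodule.smul_mem _ a (mem_realHodgePart.1 v.2)
        simpa [TensorProduct.smul_tmul'] using this
    · intro u hu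
      rw [eq_re_add_im u]
      exact add_mem ⟨1 ⊗ₜ ⟨_, rePart_mem_realHodgePart hu⟩, by simp⟩
        (Submodule.smul_mem _ _ ⟨1 ⊗ₜ ⟨_, rePart_mem_realHodgePart (Submodule.smul_mem _ (-Complex.I) hu)⟩,
          by simp⟩)
  rw [this]

lemma herm_tmul_tmul (x y : V) :
    herm Q ((1 : ℂ) ⊗ₜ[ℝ] x) ((1 : ℂ) ⊗ₜ[ℝ] y) = ((Q x y : ℝ) : ℂ) := by
  simp [herm_apply]

lemma card_hodgeIndex : Fintype.card (HodgeIndex m h) =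
    ∑ r : Fin m, h (m + 1 + r) + ∑ r : Fin m, h (m + 1 + r) + h m := by
  simp

/-- Orthonormalize each `H^{p,q}` with `p > m` over `ℂ`, conjugate to get those with `p < m`, and
orthonormalize the real part of `H^{m,m}` over `ℝ` starting from `ζ`. The coefficient of `ζ`
involves only `Q` and `ζ`, which is what makes bases at different points comparable. The case `ζ =
0` serves when only the basis is wanted. -/
theorem IsPolarizedFlag.exists_isHodgeBasis [FiniteDimensional ℝ V] (hs : Q.IsSymm)
    (hF : IsPolarizedFlag Q h F) {F₀ : Family (ℂ ⊗[ℝ] V) (2 * m)}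
    (hF₀ : F₀ ∈ periodDomain Q (2 * m) h) {ζ : V} (hζ : (1 : ℂ) ⊗ₜ[ℝ] ζ ∈ step F m) :
    ∃ e : Module.Basis (HodgeIndex m h) ℂ (ℂ ⊗[ℝ] V), IsHodgeBasis Q F e ∧
      ∀ i : Fin (h m), i.val = 0 →
        (1 : ℂ) ⊗ₜ[ℝ] ζ = ((√(Q ζ ζ) : ℝ) : ℂ) • e (Sum.inr i) := by
  have hupper : ∀ r : Fin m, ∃ b : Fin (h (m + 1 + r)) →
      hodgePart F (m + 1 + r) (2 * m - (m + 1 + r)), ∀ i j,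
      herm Q (b i : ℂ ⊗[ℝ] V) (b j) =
        if i = j then (((-1 : ℝ) ^ (m + 1 + r + m) : ℝ) : ℂ) else 0 := by
    intro r
    have hr : m + 1 + (r : ℕ) ≤ 2 * m := by have := r.2; omega
    have h2 : (((-1 : ℝ) ^ (m + 1 + r + m) : ℝ) : ℂ) * (((-1 : ℝ) ^ (m + 1 + r + m) : ℝ) : ℂ) = 1 := by
      rw [← Complex.ofReal_mul, ← mul_pow]; norm_num
    -- The sign makes the form positive definite; multiplying by it once more recovers the original
    -- Gram matrix.
    obtain ⟨b, hb, -⟩ := exists_orthonormal_of_form (𝕜 := ℂ)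
      (L := hodgePart F (m + 1 + r) (2 * m - (m + 1 + r)))
      (fun x y => (((-1 : ℝ) ^ (m + 1 + r + m) : ℝ) : ℂ) * herm Q (x : ℂ ⊗[ℝ] V) y)
      (fun x y z => by simp [mul_add]) (fun c x y => by simp [mul_left_comm])
      (fun x y => by rw [map_mul, conj_herm hs, Complex.conj_ofReal])
      (fun x hx => by
        have := hF.herm_self_pos hr x.2 (by simpa using hx)
        rwa [RCLike.re_eq_complex_re, Complex.re_ofReal_mul])
      (hF.finrank_hodgePart hF₀ hr) 0
    refine ⟨b, fun i j => ?_⟩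
    have := congrArg (fun z => (((-1 : ℝ) ^ (m + 1 + r + m) : ℝ) : ℂ) * z) (hb i j)
    simp only [← mul_assoc, h2, one_mul] at this
    rw [this]
    split_ifs <;> simp
  choose b hb using hupper
  have hmid : Module.finrank ℝ (realHodgePart F) = h m := by
    rw [finrank_realHodgePart]
    have := hF.finrank_hodgePart hF₀ (p := m) (by omega)
    rwa [show 2 * m - m = m by omega] at this
  have hm_mem : ∀ x : realHodgePart F, (1 : ℂ) ⊗ₜ[ℝ] (x : V) ∈ hodgePart F m (2 * m - m) := by
    intro x
    rw [show 2 * m - m = m by omega]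
    exact x.2
  obtain ⟨c, hc, hcζ⟩ := exists_orthonormal_of_form (𝕜 := ℝ) (L := realHodgePart F)
    (fun x y => Q x y) (fun x y z => by simp) (fun c x y => by simp)
    (fun x y => by simp [hs.eq x y]) (fun x hx => by
      have := hF.herm_self_pos (p := m) (by omega) (hm_mem x) (fun h0 => hx (by
        have := congrArg rePart h0
        simpa using this))
      rw [herm_tmul_tmul, Even.neg_one_pow ⟨m, rfl⟩, one_mul, Complex.ofReal_re] at this
      simpa using this) hmid ⟨ζ, mem_realHodgePart_iff.2 hζ⟩
  let f : HodgeIndex m h → ℂ ⊗[ℝ] V :=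
    Sum.elim (Sum.elim (fun x => b x.1 x.2) (fun x => conj (b x.1 x.2 : ℂ ⊗[ℝ] V)))
      (fun i => (1 : ℂ) ⊗ₜ[ℝ] (c i : V))
  have hmem : ∀ i, f i ∈ hodgePart F (deg i) (2 * m - deg i) := by
    rintro ((⟨r, s⟩ | ⟨r, s⟩) | i)
    · exact (b r s).2
    · have := conj_mem_hodgePart (b r s).2
      have hr := r.2
      simp only [f, deg, Sum.elim_inl, Sum.elim_inr]
      rwa [show 2 * m - (m - 1 - (r : ℕ)) = m + 1 + r by omega,
        show m - 1 - (r : ℕ) = 2 * m - (m + 1 + r) by omega]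
    · exact hm_mem (c i)
  have hsgn : ∀ i, herm Q (f i) (f i) = sgn i := by
    rintro ((⟨r, s⟩ | ⟨r, s⟩) | i)
    · exact (hb r s s).trans (if_pos rfl)
    · rw [show (Sum.inl (Sum.inr ⟨r, s⟩) : HodgeIndex m h) = swap (Sum.inl (Sum.inl ⟨r, s⟩))
        from rfl, sgn_swap]
      show herm Q (conj (b r s : ℂ ⊗[ℝ] V)) (conj (b r s : ℂ ⊗[ℝ] V)) = _
      rw [NoetherLefschetz.herm_apply, baseChange_conj_conj, ← NoetherLefschetz.herm_apply,
        hb r s s, if_pos rfl, Complex.conj_ofReal]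
      rfl
    · show herm Q ((1 : ℂ) ⊗ₜ[ℝ] (c i : V)) ((1 : ℂ) ⊗ₜ[ℝ] (c i : V)) = _
      have := hc i i
      simp only [if_true] at this
      rw [herm_tmul_tmul, this]
      simp [sgn, deg]
  have horth : ∀ i j, i ≠ j → herm Q (f i) (f j) = 0 := by
    intro i j hij
    by_cases hd : deg i = deg j
    · rcases i with (⟨r, s⟩ | ⟨r, s⟩) | i <;> rcases j with (⟨r', s'⟩ | ⟨r', s'⟩) | j <;>
        simp only [deg, Sum.elim_inl, Sum.elim_inr] at hd
      · obtain rfl : r = r' := Fin.ext (by omega)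
        exact (hb r s s').trans (if_neg fun hss => hij (by rw [hss]))
      · omega
      · omega
      · omega
      · obtain rfl : r = r' := Fin.ext (by omega)
        show herm Q (conj (b r s : ℂ ⊗[ℝ] V)) (conj (b r s' : ℂ ⊗[ℝ] V)) = _
        rw [NoetherLefschetz.herm_apply, baseChange_conj_conj, ← NoetherLefschetz.herm_apply,
          hb r s s', if_neg fun hss => hij (by rw [hss]), map_zero]
      · omega
      · omega
      · omega
      · show herm Q ((1 : ℂ) ⊗ₜ[ℝ] (c i : V)) ((1 : ℂ) ⊗ₜ[ℝ] (c j : V)) = _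
        have := hc i j
        rw [if_neg fun hij' => hij (by rw [hij'])] at this
        rw [herm_tmul_tmul, this]
        simp
    · exact hF.herm_hodgePart hs (deg_le i) (deg_le j) hd (hmem i) (hmem j)
  have hli : LinearIndependent ℂ f := linearIndependent_of_herm (s := fun i => (sgn i : ℂ))
    (fun i => by exact_mod_cast sgn_ne_zero i) hsgn horth
  -- Hodge symmetry, needed because the index set counts only the Hodge numbers with `p ≥ m`.
  have hsym : ∀ r : Fin m, h (m - 1 - r) = h (m + 1 + r) := by
    intro r
    have hr := r.2
    rw [← hF.finrank_hodgePart hF₀ (p := m - 1 - r) (by omega),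
      ← hF.finrank_hodgePart hF₀ (p := m + 1 + r) (by omega), finrank_hodgePart_comm,
      show 2 * m - (m - 1 - (r : ℕ)) = m + 1 + r by omega,
      show m - 1 - (r : ℕ) = 2 * m - (m + 1 + r) by omega]
  have hcard : Fintype.card (HodgeIndex m h) = Module.finrank ℂ (ℂ ⊗[ℝ] V) := by
    have h0 := hF.finrank 0
    rw [step_zero hF.zero_eq_top, finrank_top] at h0
    rw [h0, card_hodgeIndex, Finset.sum_Ico_eq_sum_range, Nat.sub_zero,
      show 2 * m + 1 = m + (1 + m) by omega, Finset.sum_range_add, Finset.sum_range_add,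
      ← Finset.sum_range_reflect]
    simp only [Finset.sum_range, zero_add]
    simp only [hsym]
    simp [add_comm, add_left_comm]
  refine ⟨basisOfLinearIndependentOfCardEqFinrank' f hli hcard, ⟨?_, ?_, ?_⟩, ?_⟩
  · simpa using hmem
  · rintro ((i | i) | i) <;> simp [f, swap]
  · intro i j
    by_cases hij : i = j
    · subst hij; simp [hsgn]
    · simp [horth i j hij, hij]
  · intro i hi
    have := hcζ i hi
    have h1 := congrArg (fun x : realHodgePart F => (1 : ℂ) ⊗ₜ[ℝ] (x : V)) this
    simp only [coe_basisOfLinearIndependentOfCardEqFinrank', f, Sum.elim_inr]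
    rw [h1]
    simp [TensorProduct.smul_tmul', TensorProduct.tmul_smul]

end HodgeBasis

/-! ### Forms, conjugation and filtration in Hodge coordinates. -/

section Coordinates

variable {V : Type*} [AddCommGroup V] [Module ℝ V] {Q : LinearMap.BilinForm ℝ V} {m : ℕ}
  {h : ℕ → ℕ} {F : Family (ℂ ⊗[ℝ] V) (2 * m)}
  {e : Module.Basis (HodgeIndex m h) ℂ (ℂ ⊗[ℝ] V)}

namespace IsHodgeBasis

lemma herm_eq_sum (he : IsHodgeBasis Q F e) (x y : ℂ ⊗[ℝ] V) :
    herm Q x y = ∑ i, (sgn i : ℂ) * (e.repr x i * starRingEnd ℂ (e.repr y i)) := by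
  conv_lhs => rw [← e.sum_repr x, ← e.sum_repr y]
  simp only [map_sum, LinearMap.sum_apply, map_smul, LinearMap.smul_apply, LinearMap.map_smulₛₗ,
    he.herm_apply, smul_eq_mul]
  simp only [mul_ite, mul_zero, Finset.sum_ite_eq', Finset.mem_univ, if_true]
  exact Finset.sum_congr rfl fun i _ => by ring

lemma herm_basis_right (he : IsHodgeBasis Q F e) (x : ℂ ⊗[ℝ] V) (i : HodgeIndex m h) :
    herm Q x (e i) = sgn i * e.repr x i := by
  rw [he.herm_eq_sum, Finset.sum_eq_single i]
  · simp
  · intro j _ hj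
    simp [hj.symm]
  · simp

lemma repr_conj (he : IsHodgeBasis Q F e) (x : ℂ ⊗[ℝ] V) (i : HodgeIndex m h) :
    e.repr (conj x) i = starRingEnd ℂ (e.repr x (swap i)) := by
  have h1 : (sgn i : ℂ) ≠ 0 := by exact_mod_cast sgn_ne_zero i
  apply mul_left_cancel₀ h1
  rw [← he.herm_basis_right, NoetherLefschetz.herm_apply, he.conj_apply, ← conj_conj (e (swap i)),
    baseChange_conj_conj, ← NoetherLefschetz.herm_apply, he.herm_basis_right, map_mul, Complex.conj_ofReal, sgn_swap]

lemma baseChange_eq_sum (he : IsHodgeBasis Q F e) (x y : ℂ ⊗[ℝ] V) :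
    Q.baseChange ℂ x y = ∑ i, (sgn i : ℂ) * (e.repr x i * e.repr y (swap i)) := by
  rw [baseChange_eq_herm, he.herm_eq_sum]
  simp [he.repr_conj]

/-- Pairing with `e i` reads off the `i`-th coordinate up to sign, and the first relation kills this
pairing on `F^p` as soon as `deg i < p`. -/
lemma mem_step_iff (he : IsHodgeBasis Q F e) (hF : IsPolarizedFlag Q h F) {p : ℕ}
    {x : ℂ ⊗[ℝ] V} : x ∈ step F p ↔ ∀ i, deg i < p → e.repr x i = 0 := by
  constructor
  · intro hx i hi
    have h1 : (sgn i : ℂ) ≠ 0 := by exact_mod_cast sgn_ne_zero i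
    have hd := deg_le i
    apply (mul_eq_zero.1 (?_ : (sgn i : ℂ) * e.repr x i = 0)).resolve_left h1
    rw [← he.herm_basis_right]
    refine hF.first (deg i + 1) (by omega) x (step_antitone hF.antitone hi hx) _ ?_
    rw [show 2 * m + 1 - (deg i + 1) = 2 * m - deg i by omega]
    exact mem_conjSubspace.1 (he.mem i).2
  · intro hx
    rw [← e.sum_repr x]
    refine Submodule.sum_mem _ fun i _ => ?_
    by_cases hi : deg i < p
    · rw [hx i hi, zero_smul]; exact zero_mem _
    · exact Submodule.smul_mem _ _ (step_antitone hF.antitone (not_lt.1 hi) (he.mem i).1)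

end IsHodgeBasis

/-- The Weil operator has to be constructed: it multiplies the Hodge basis vector `e i` by `sgn i`,
so that `Q (C u, conj u)` becomes the sum of the squared absolute values of the coordinates of `u`.
-/
lemma mem_periodDomain [FiniteDimensional ℝ V] (hs : Q.IsSymm) (hF : IsPolarizedFlag Q h F)
    {F₀ : Family (ℂ ⊗[ℝ] V) (2 * m)} (hF₀ : F₀ ∈ periodDomain Q (2 * m) h) :
    F ∈ periodDomain Q (2 * m) h := by
  obtain ⟨e, he, -⟩ := hF.exists_isHodgeBasis hs hF₀ (ζ := 0) (by simp)
  let C := e.constr ℂ (fun i => (sgn i : ℂ) • e i)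
  have hC : ∀ u i, e.repr (C u) i = sgn i * e.repr u i := by
    intro u i
    simp only [C, Module.Basis.constr_apply_fintype, map_sum, map_smul, Module.Basis.repr_self,
      Finsupp.coe_finsetSum, Finset.sum_apply, Finsupp.smul_apply, smul_eq_mul]
    rw [Finset.sum_eq_single i]
    · simp [mul_comm]
    · intro j _ hj
      simp [hj]
    · simp
  refine ⟨⟨hF.isHodgeFiltration hF₀, hF.first, C, ?_, ?_⟩, ?_⟩
  · intro p q hpq u hu
    obtain rfl : q = 2 * m - p := by omega
    rw [I_zpow_sub (by omega : p ≤ 2 * m)]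
    refine e.ext_elem fun i => ?_
    rw [hC, map_smul, Finsupp.smul_apply, smul_eq_mul]
    by_cases hi : deg i = p
    · rw [sgn, hi]
    · have h1 : (sgn i : ℂ) ≠ 0 := by exact_mod_cast sgn_ne_zero i
      have h2 : (sgn i : ℂ) * e.repr u i = 0 := by
        rw [← he.herm_basis_right]
        exact hF.herm_hodgePart hs (by omega) (deg_le i) (fun h' => hi h'.symm) hu (he.mem i)
      rw [(mul_eq_zero.1 h2).resolve_left h1, mul_zero, mul_zero]
  · intro u hu
    have : Q.baseChange ℂ (C u) (conj u) = ((∑ i, ‖e.repr u i‖ ^ 2 : ℝ) : ℂ) := by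
      rw [← herm_apply, he.herm_eq_sum, Complex.ofReal_sum]
      refine Finset.sum_congr rfl fun i _ => ?_
      rw [hC, mul_assoc, Complex.mul_conj, ← mul_assoc, ← Complex.ofReal_mul, sgn_mul_self,
        Complex.ofReal_one, one_mul, Complex.normSq_eq_norm_sq]
    rw [this]
    refine ⟨?_, Complex.ofReal_im _⟩
    rw [Complex.ofReal_re]
    obtain ⟨i, hi⟩ : ∃ i, e.repr u i ≠ 0 := by
      by_contra! h0
      exact hu (e.ext_elem fun i => by simp [h0 i])
    exact Finset.sum_pos' (fun i _ => by positivity) ⟨i, Finset.mem_univ _, by positivity⟩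
  · intro p q hpq
    obtain rfl : q = 2 * m - p := by omega
    exact hF.finrank_hodgePart hF₀ (by omega)

end Coordinates

/-! ### The real group acting on filtrations; transitivity. -/

section Action

variable {V : Type*} [AddCommGroup V] [Module ℝ V] {Q : LinearMap.BilinForm ℝ V} {m : ℕ}
  {h : ℕ → ℕ}

@[simp] lemma complexify_tmul (g : V ≃ₗ[ℝ] V) (a : ℂ) (v : V) :
    complexify g (a ⊗ₜ[ℝ] v) = a ⊗ₜ[ℝ] g v := by
  simp [complexify]

lemma complexify_comp_symm (g : V ≃ₗ[ℝ] V) (x : ℂ ⊗[ℝ] V) :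
    complexify g (complexify g.symm x) = x := by
  induction x using TensorProduct.induction_on with
  | zero => simp
  | tmul a v => simp
  | add x y hx hy => simp only [map_add, hx, hy]

lemma complexify_injective (g : V ≃ₗ[ℝ] V) : Function.Injective (complexify g) :=
  Function.LeftInverse.injective (g := complexify g.symm) fun x => by
    simpa using complexify_comp_symm g.symm x

lemma complexify_surjective (g : V ≃ₗ[ℝ] V) : Function.Surjective (complexify g) :=
  fun x => ⟨_, complexify_comp_symm g x⟩

lemma conj_complexify (g : V ≃ₗ[ℝ] V) (x : ℂ ⊗[ℝ] V) :
    conj (complexify g x) = complexify g (conj x) := by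
  induction x using TensorProduct.induction_on with
  | zero => simp
  | tmul a v => simp
  | add x y hx hy => simp only [map_add, hx, hy]

lemma baseChange_complexify {g : V ≃ₗ[ℝ] V} (hg : g ∈ isometryGroup Q) (x y : ℂ ⊗[ℝ] V) :
    Q.baseChange ℂ (complexify g x) (complexify g y) = Q.baseChange ℂ x y := by
  induction x using TensorProduct.induction_on with
  | zero => simp
  | add x x' hx hy => simp only [map_add, LinearMap.add_apply, hx, hy]
  | tmul a v =>
    induction y using TensorProduct.induction_on with
    | zero => simp
    | add x y hx hy => simp only [map_add, hx, hy]
    | tmul b w =>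
      have : Q (g v) (g w) = Q v w := hg v w
      simp [this]

lemma herm_complexify {g : V ≃ₗ[ℝ] V} (hg : g ∈ isometryGroup Q) (x y : ℂ ⊗[ℝ] V) :
    herm Q (complexify g x) (complexify g y) = herm Q x y := by
  rw [herm_apply, conj_complexify, baseChange_complexify hg, herm_apply]

lemma step_translate {n : ℕ} (g : V ≃ₗ[ℝ] V) (F : Family (ℂ ⊗[ℝ] V) n) (p : ℕ) :
    step (translate g F) p = (step F p).map (complexify g) := by
  by_cases hp : p < n + 1
  · rw [step_of_lt hp, step_of_lt hp]; rfl
  · rw [step_of_gt (by omega), step_of_gt (by omega), Submodule.map_bot]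

lemma IsPolarizedFlag.translate {F : Family (ℂ ⊗[ℝ] V) (2 * m)} (hF : IsPolarizedFlag Q h F)
    {g : V ≃ₗ[ℝ] V} (hg : g ∈ isometryGroup Q) : IsPolarizedFlag Q h (translate g F) where
  antitone := fun p q hpq => Submodule.map_mono (hF.antitone hpq)
  zero_eq_top := by
    show (F 0).map _ = ⊤
    rw [hF.zero_eq_top, Submodule.map_top, LinearMap.range_eq_top]
    exact complexify_surjective g
  first := by
    intro p hp x hx y hy
    rw [step_translate] at hx hy
    obtain ⟨x, hx, rfl⟩ := hx
    obtain ⟨y, hy, rfl⟩ := hy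
    rw [baseChange_complexify hg]
    exact hF.first p hp x hx y hy
  finrank := fun p => by
    rw [step_translate, ← (Submodule.equivMapOfInjective _ (complexify_injective g) _).finrank_eq]
    exact hF.finrank p
  positive := by
    intro p hp x hx horth hx0
    rw [step_translate] at hx horth
    obtain ⟨x, hx, rfl⟩ := hx
    rw [herm_complexify hg]
    refine hF.positive p hp x hx (fun v hv => ?_) fun h0 => hx0 (by rw [h0, map_zero])
    rw [← herm_complexify hg]
    exact horth _ ⟨v, hv, rfl⟩

lemma mem_noetherLefschetzLocus_iff {F : Family (ℂ ⊗[ℝ] V) (2 * m)} {ζ : V} :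
    F ∈ noetherLefschetzLocus Q m h ζ ↔
      F ∈ periodDomain Q (2 * m) h ∧ (1 : ℂ) ⊗ₜ[ℝ] ζ ∈ step F m :=
  and_congr_right fun _ => mem_realHodgePart_iff

lemma translate_mem_noetherLefschetzLocus [FiniteDimensional ℝ V] (hs : Q.IsSymm)
    {F : Family (ℂ ⊗[ℝ] V) (2 * m)} {ζ : V} (hF : F ∈ noetherLefschetzLocus Q m h ζ)
    {g : V ≃ₗ[ℝ] V} (hg : g ∈ lineStabilizer Q ζ) :
    translate g F ∈ noetherLefschetzLocus Q m h ζ := by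
  rw [mem_noetherLefschetzLocus_iff] at hF ⊢
  obtain ⟨hF, hζ⟩ := hF
  obtain ⟨hg, c, hc⟩ := hg
  refine ⟨mem_periodDomain hs ((isPolarizedFlag_of_mem hF).translate hg) hF, ?_⟩
  have h1 : (c : ℂ) • ((1 : ℂ) ⊗ₜ[ℝ] ζ) ∈ step (translate g F) m := by
    rw [step_translate]
    refine ⟨_, hζ, ?_⟩
    rw [complexify_tmul, hc, TensorProduct.tmul_smul, TensorProduct.smul_tmul',
      TensorProduct.smul_tmul']
    simp
  exact (Submodule.smul_mem_iff _ (by simp)).1 h1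

/-- A complex-linear automorphism which commutes with conjugation is defined over the reals. -/
lemma exists_complexify_eq [FiniteDimensional ℝ V] (T : (ℂ ⊗[ℝ] V) →ₗ[ℂ] (ℂ ⊗[ℝ] V))
    (hinj : Function.Injective T) (hT : ∀ x, conj (T x) = T (conj x)) :
    ∃ g : V ≃ₗ[ℝ] V, ∀ x, complexify g x = T x := by
  let g₀ : V →ₗ[ℝ] V := rePart ∘ₗ T.restrictScalars ℝ ∘ₗ TensorProduct.mk ℝ ℂ V 1
  have h1 : ∀ v, (1 : ℂ) ⊗ₜ[ℝ] g₀ v = T ((1 : ℂ) ⊗ₜ[ℝ] v) := fun v =>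
    (eq_tmul_of_conj_eq (u := T ((1 : ℂ) ⊗ₜ[ℝ] v)) (by rw [hT]; simp)).symm
  have hinj₀ : Function.Injective g₀ := fun v w hvw => by
    have h2 := h1 v
    rw [hvw, h1 w] at h2
    simpa using congrArg rePart (hinj h2.symm)
  refine ⟨LinearEquiv.ofInjectiveEndo g₀ hinj₀, fun x => ?_⟩
  induction x using TensorProduct.induction_on with
  | zero => simp
  | add x y hx hy => simp only [map_add, hx, hy]
  | tmul a v =>
    have h2 : a ⊗ₜ[ℝ] v = a • ((1 : ℂ) ⊗ₜ[ℝ] v) := by simp [TensorProduct.smul_tmul']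
    rw [h2, map_smul, map_smul, ← h1, complexify_tmul]
    rfl

/-- The map `T` that matches Hodge bases at `F` and `F'` keeps coordinates, and conjugation, the
hermitian form and the filtration have the same expression in both systems of coordinates. -/
lemma exists_translate_eq [FiniteDimensional ℝ V] (hs : Q.IsSymm)
    {F F' : Family (ℂ ⊗[ℝ] V) (2 * m)} {ζ : V} (hζ : ζ ≠ 0)
    (hF : F ∈ noetherLefschetzLocus Q m h ζ) (hF' : F' ∈ noetherLefschetzLocus Q m h ζ) :
    ∃ g ∈ lineStabilizer Q ζ, translate g F = F' := by
  rw [mem_noetherLefschetzLocus_iff] at hF hF'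
  have hP := isPolarizedFlag_of_mem hF.1
  have hP' := isPolarizedFlag_of_mem hF'.1
  obtain ⟨e, he, heζ⟩ := hP.exists_isHodgeBasis hs hF.1 hF.2
  obtain ⟨e', he', heζ'⟩ := hP'.exists_isHodgeBasis hs hF.1 hF'.2
  let T := e.equiv e' (Equiv.refl _)
  have hrepr : ∀ x i, e'.repr (T x) i = e.repr x i := by
    intro x i
    simp [T, Module.Basis.equiv]
  obtain ⟨g, hg⟩ := exists_complexify_eq T.toLinearMap T.injective (fun x => by
    refine e'.ext_elem fun i => ?_
    simp only [LinearEquiv.coe_coe]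
    rw [he'.repr_conj, hrepr, hrepr, he.repr_conj])
  have hpos : 0 < h m := by
    have h1 := finrank_realHodgePart (F := F)
    have h2 := hF.1.2 m m (by omega)
    rw [← h2, ← h1]
    have : Nontrivial (realHodgePart F) :=
      ⟨⟨⟨ζ, mem_realHodgePart_iff.2 hF.2⟩, 0, fun h0 => hζ (congrArg Subtype.val h0)⟩⟩
    exact Module.finrank_pos
  refine ⟨g, ⟨?_, 1, ?_⟩, ?_⟩
  · intro x y
    have h1 : herm Q (complexify g ((1 : ℂ) ⊗ₜ[ℝ] x)) (complexify g ((1 : ℂ) ⊗ₜ[ℝ] y)) =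
        herm Q ((1 : ℂ) ⊗ₜ[ℝ] x) ((1 : ℂ) ⊗ₜ[ℝ] y) := by
      rw [hg, hg, he'.herm_eq_sum, he.herm_eq_sum]
      simp only [LinearEquiv.coe_coe, hrepr]
    simpa [herm_tmul_tmul] using h1
  -- Both bases give `ζ` the same coefficient `√(Q ζ ζ)` on the vector of index `0`, so `g` fixes
  -- `ζ` itself and the scalar is `1`.
  · have h1 : complexify g ((1 : ℂ) ⊗ₜ[ℝ] ζ) = (1 : ℂ) ⊗ₜ[ℝ] ζ := by
      rw [hg, heζ ⟨0, hpos⟩ rfl, map_smul]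
      conv_rhs => rw [← heζ ⟨0, hpos⟩ rfl, heζ' ⟨0, hpos⟩ rfl]
      simp [T]
    simpa using congrArg rePart h1
  · funext p
    have h1 : step (translate g F) p = step F' p := by
      ext x
      rw [step_translate, he'.mem_step_iff hP']
      constructor
      · rintro ⟨y, hy, rfl⟩ i hi
        rw [hg]
        exact (hrepr y i).trans ((he.mem_step_iff hP).1 hy i hi)
      · intro hx
        obtain ⟨y, rfl⟩ := T.surjective x
        exact ⟨y, (he.mem_step_iff hP).2 fun i hi => (hrepr y i).symm.trans (hx i hi), hg y⟩
    rwa [step_of_lt p.2, step_of_lt p.2] at h1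

end Action

/-! ### Analyticity of determinants and adjugates. -/

section AnalyticMatrix

variable {E : Type*} [NormedAddCommGroup E] [NormedSpace ℂ E] {ι : Type*} [Fintype ι]
  [DecidableEq ι]

lemma analyticAt_det {A : E → Matrix ι ι ℂ} {x : E}
    (hA : ∀ i j, AnalyticAt ℂ (fun q => A q i j) x) : AnalyticAt ℂ (fun q => (A q).det) x := by
  simp only [Matrix.det_apply]
  refine Finset.analyticAt_fun_sum _ fun σ _ => ?_
  exact (Finset.analyticAt_fun_prod _ fun i _ => hA _ _).const_smul

lemma analyticAt_adjugate {A : E → Matrix ι ι ℂ} {x : E}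
    (hA : ∀ i j, AnalyticAt ℂ (fun q => A q i j) x) (i j : ι) :
    AnalyticAt ℂ (fun q => (A q).adjugate i j) x := by
  simp only [Matrix.adjugate_apply]
  refine analyticAt_det fun r c => ?_
  by_cases hr : r = j
  · simp only [Matrix.updateRow_apply, hr, if_true]
    exact analyticAt_const
  · simp only [Matrix.updateRow_apply, hr, if_false]
    exact hA r c

end AnalyticMatrix

/-! ### Holomorphy of the linear action on the product of Grassmannians. -/

section Charts

variable {W : Type*} [AddCommGroup W] [Module ℂ W] {n : ℕ}

/-- The image of an affine chart under a linear automorphism. -/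
noncomputable def AffineChart.map {x : Family W n} (κ : AffineChart x) (T : W ≃ₗ[ℂ] W) :
    AffineChart (x.map T.toLinearMap) where
  k := κ.k
  l := κ.l
  basis p := (κ.basis p).map T
  span_eq p := by
    show _ = (x p).map T.toLinearMap
    rw [← κ.span_eq p, Submodule.map_span, ← Set.range_comp]
    rfl

lemma span_eq_span_of_matrix {ι : Type*} [Fintype ι] [DecidableEq ι] {v w : ι → W}
    {A : Matrix ι ι ℂ} (hA : A.det ≠ 0) (h : ∀ i, v i = ∑ j, A i j • w j) :
    Submodule.span ℂ (Set.range v) = Submodule.span ℂ (Set.range w) := by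
  have hA' : IsUnit A.det := isUnit_iff_ne_zero.2 hA
  apply le_antisymm <;> rw [Submodule.span_le]
  · rintro _ ⟨i, rfl⟩
    rw [h i]
    exact Submodule.sum_mem _ fun j _ =>
      Submodule.smul_mem _ _ (Submodule.subset_span ⟨j, rfl⟩)
  · rintro _ ⟨i, rfl⟩
    have : w i = ∑ j, A⁻¹ i j • v j := by
      simp only [h, Finset.smul_sum, smul_smul]
      rw [Finset.sum_comm]
      simp only [← Finset.sum_smul, ← Matrix.mul_apply, Matrix.nonsing_inv_mul A hA',
        Matrix.one_apply]
      simp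
    rw [this]
    exact Submodule.sum_mem _ fun j _ =>
      Submodule.smul_mem _ _ (Submodule.subset_span ⟨j, rfl⟩)

/-- The action of linear automorphisms on the product of Grassmannians is holomorphic. -/
theorem actsHolomorphicallyAt [FiniteDimensional ℂ W] {x : Family W n} (κ : AffineChart x)
    (T : W ≃ₗ[ℂ] W) : ActsHolomorphicallyAt T.toLinearMap x := by
  classical
  let N := Module.finrank ℂ W
  let fb := Module.finBasis ℂ W
  let t : (Fin N → Fin N → ℂ) →ₗ[ℂ] (W →ₗ[ℂ] W) :=
    (Matrix.toLin fb fb).toLinearMap ∘ₗ (Matrix.ofLinearEquiv ℂ).toLinearMap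
  let ℓ : ∀ p, (Fin (κ.k p) ⊕ Fin (κ.l p)) → (Fin (κ.k p) ⊕ Fin (κ.l p)) →
      (Fin N → Fin N → ℂ) →ₗ[ℂ] ℂ := fun p r c =>
    ((κ.basis p).map T).coord c ∘ₗ LinearMap.applyₗ (κ.basis p r) ∘ₗ t
  let M : ∀ p, (Fin N → Fin N → ℂ) × κ.Coord → Fin (κ.k p) → (Fin (κ.k p) ⊕ Fin (κ.l p)) → ℂ :=
    fun p q i c => ℓ p (Sum.inl i) c q.1 + ∑ j, q.2 p i j * ℓ p (Sum.inr j) c q.1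
  let α : ∀ p, (Fin N → Fin N → ℂ) × κ.Coord → Matrix (Fin (κ.k p)) (Fin (κ.k p)) ℂ :=
    fun p q => Matrix.of fun i j => M p q i (Sum.inl j)
  let β : ∀ p, (Fin N → Fin N → ℂ) × κ.Coord → Matrix (Fin (κ.k p)) (Fin (κ.l p)) ℂ :=
    fun p q => Matrix.of fun i j => M p q i (Sum.inr j)
  -- The transformed spanning vectors have coefficient rows `(α | β)` in the image basis;
  -- multiplication by `α⁻¹` turns them into `(1 | α⁻¹ β)`. Writing `α⁻¹` through the adjugate makes
  -- analyticity visible.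
  let ψ : (Fin N → Fin N → ℂ) × κ.Coord → (κ.map T).Coord := fun q p i j =>
    ((α p q).det)⁻¹ * ∑ r, (α p q).adjugate i r * β p q r j
  set q₀ : (Fin N → Fin N → ℂ) × κ.Coord := (fun i j => LinearMap.toMatrix fb fb T.toLinearMap i j, 0)
    with hq₀
  have hM : ∀ p i c, AnalyticAt ℂ (fun q => M p q i c) q₀ := by
    intro p i c
    have hℓ : ∀ r, AnalyticAt ℂ (fun q : (Fin N → Fin N → ℂ) × κ.Coord => ℓ p r c q.1) q₀ :=
      fun r => ((ℓ p r c ∘ₗ LinearMap.fst ℂ _ κ.Coord).toContinuousLinearMap).analyticAt q₀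
    refine (hℓ _).add (Finset.analyticAt_fun_sum _ fun j _ => AnalyticAt.mul ?_ (hℓ _))
    exact ((LinearMap.proj j ∘ₗ LinearMap.proj i ∘ₗ LinearMap.proj p ∘ₗ
      LinearMap.snd ℂ (Fin N → Fin N → ℂ) κ.Coord).toContinuousLinearMap).analyticAt q₀
  have ht₀ : t q₀.1 = T.toLinearMap := Matrix.toLin_toMatrix fb fb T.toLinearMap
  -- At the base point `T` carries the basis to its image, so `α = 1` there and `det α` stays
  -- nonzero nearby.
  have hα₀ : ∀ p, α p q₀ = 1 := by
    intro p
    ext i j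
    have h1 : ℓ p (Sum.inl i) (Sum.inl j) q₀.1 =
        ((κ.basis p).map T).repr (T.toLinearMap (κ.basis p (Sum.inl i))) (Sum.inl j) := by
      rw [← ht₀]; rfl
    have h2 : α p q₀ i j = ℓ p (Sum.inl i) (Sum.inl j) q₀.1 := by
      simp [α, M, hq₀]
    rw [h2, h1]
    simp [Matrix.one_apply, Finsupp.single_apply]
  have hdet : ∀ p, AnalyticAt ℂ (fun q => (α p q).det) q₀ := fun p =>
    analyticAt_det fun i j => hM p i (Sum.inl j)
  refine ⟨κ, κ.map T, ψ, ?_, ?_⟩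
  · refine AnalyticAt.pi fun p => AnalyticAt.pi fun i => AnalyticAt.pi fun j => ?_
    refine AnalyticAt.mul ((hdet p).inv (by rw [hα₀]; simp)) ?_
    exact Finset.analyticAt_fun_sum _ fun r _ =>
      (analyticAt_adjugate (fun i j => hM p i (Sum.inl j)) i r).mul (hM p r (Sum.inr j))
  · have hev : ∀ᶠ q in 𝓝 q₀, ∀ p, (α p q).det ≠ 0 := by
      rw [Filter.eventually_all]
      exact fun p => (hdet p).continuousAt.eventually_ne (by rw [hα₀]; simp)
    filter_upwards [hev] with q hq
    funext p
    show Submodule.map (t q.1) (Submodule.span ℂ _) = Submodule.span ℂ _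
    rw [Submodule.map_span, ← Set.range_comp]
    refine span_eq_span_of_matrix (hq p) fun i => ?_
    have hL : ∀ r, t q.1 (κ.basis p r) = ∑ c, ℓ p r c q.1 • ((κ.basis p).map T) c := fun r =>
      (((κ.basis p).map T).sum_repr _).symm
    have h1 : t q.1 (κ.basis p (Sum.inl i) + ∑ j, q.2 p i j • κ.basis p (Sum.inr j)) =
        ∑ c, M p q i c • ((κ.basis p).map T) c := by
      simp only [map_add, map_sum, map_smul, hL, M, add_smul, Finset.sum_add_distrib,
        Finset.sum_smul, Finset.smul_sum, smul_smul]
      congr 1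
      exact Finset.sum_comm
    have h2 : ∀ j : Fin (κ.l p), ∑ r, α p q i r * ψ q p r j = β p q i j := by
      intro j
      have h3 : α p q * ((α p q).det⁻¹ • ((α p q).adjugate * β p q)) = β p q := by
        rw [Matrix.mul_smul, ← Matrix.mul_assoc, Matrix.mul_adjugate, Matrix.smul_mul,
          Matrix.one_mul, smul_smul, inv_mul_cancel₀ (hq p), one_smul]
      have h4 := congrFun (congrFun h3 i) j
      rw [Matrix.mul_apply] at h4
      rw [← h4]
      exact Finset.sum_congr rfl fun r _ => by simp [Matrix.mul_apply, ψ]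
    refine h1.trans ?_
    rw [Fintype.sum_sum_type]
    simp only [smul_add, Finset.sum_add_distrib, Finset.smul_sum, smul_smul]
    congr 1
    rw [Finset.sum_comm]
    refine Finset.sum_congr rfl fun j _ => ?_
    rw [← Finset.sum_smul]
    congr 1
    exact (h2 j).symm

end Charts

/-! ### Subspaces given as graphs over coordinate subspaces. -/

section Graphs

variable {W : Type*} [AddCommGroup W] [Module ℂ W] {I : Type*} [Fintype I] [DecidableEq I]

/-- The vector `e i + ∑ j, a i j • e j`. -/
noncomputable def graphVec (e : Module.Basis I ℂ W) (a : I → I → ℂ) (i : I) : W :=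
  e i + ∑ j, a i j • e j

variable (e : Module.Basis I ℂ W) (d : I → ℕ)

lemma repr_graphVec (a : I → I → ℂ) (i k : I) :
    e.repr (graphVec e a i) k = (if i = k then 1 else 0) + a i k := by
  simp [graphVec, Finsupp.single_apply]

/-- The span of the vectors `e i + ∑ j, a i j • e j` with `p ≤ d i`. -/
noncomputable def graphSpan (a : I → I → ℂ) (p : ℕ) : Submodule ℂ W :=
  Submodule.span ℂ (Set.range fun i : {i // p ≤ d i} => graphVec e a i)

variable {d} {e} {a : I → I → ℂ} {p : ℕ}

omit [DecidableEq I] in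
lemma graphVec_mem {i : I} (hi : p ≤ d i) : graphVec e a i ∈ graphSpan e d a p :=
  Submodule.subset_span ⟨⟨i, hi⟩, rfl⟩

/-- A vector of a graph is determined by its components along the source of the graph. -/
lemma eq_sum_of_mem_graphSpan (ha : ∀ i j, ¬ (p ≤ d i ∧ d j < p) → a i j = 0) {v : W}
    (hv : v ∈ graphSpan e d a p) :
    v = ∑ k, if p ≤ d k then e.repr v k • graphVec e a k else 0 := by
  induction hv using Submodule.span_induction with
  | zero => simp
  | add x y _ _ hx hy =>
    conv_lhs => rw [hx, hy]
    rw [← Finset.sum_add_distrib]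
    refine Finset.sum_congr rfl fun k _ => ?_
    split_ifs <;> simp [add_smul]
  | smul c x _ hx =>
    conv_lhs => rw [hx]
    rw [Finset.smul_sum]
    refine Finset.sum_congr rfl fun k _ => ?_
    split_ifs <;> simp [mul_smul]
  | mem x hx =>
    obtain ⟨⟨i, hi⟩, rfl⟩ := hx
    dsimp only
    rw [Finset.sum_eq_single i]
    · rw [if_pos hi, repr_graphVec, if_pos rfl, ha i i (by omega)]
      simp
    · intro k _ hk
      split_ifs with hp
      · rw [repr_graphVec, if_neg hk.symm, ha i k (by omega)]
        simp
      · rfl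
    · simp

/-- The components of index `k` with `p ≤ d k` are free and determine the others. The sum may run
over all `k` since `a k j` vanishes for the remaining ones. -/
lemma mem_graphSpan_iff (ha : ∀ i j, ¬ (p ≤ d i ∧ d j < p) → a i j = 0) {v : W} :
    v ∈ graphSpan e d a p ↔ ∀ j, d j < p → e.repr v j = ∑ k, e.repr v k * a k j := by
  have hsum : ∀ j, d j < p →
      e.repr (∑ k, if p ≤ d k then e.repr v k • graphVec e a k else 0) j =
        ∑ k, e.repr v k * a k j := by
    intro j hj
    rw [map_sum, Finsupp.coe_finsetSum, Finset.sum_apply]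
    refine Finset.sum_congr rfl fun k _ => ?_
    split_ifs with hk
    · rw [map_smul, Finsupp.smul_apply, repr_graphVec, if_neg (by rintro rfl; omega)]
      simp
    · rw [ha k j (by omega)]
      simp
  constructor
  · intro hv j hj
    conv_lhs => rw [eq_sum_of_mem_graphSpan ha hv]
    exact hsum j hj
  · intro hv
    have : v = ∑ k, if p ≤ d k then e.repr v k • graphVec e a k else 0 := by
      refine e.ext_elem fun j => ?_
      by_cases hj : d j < p
      · rw [hv j hj, hsum j hj]
      · rw [map_sum, Finsupp.coe_finsetSum, Finset.sum_apply, Finset.sum_eq_single j]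
        · rw [if_pos (not_lt.1 hj), map_smul, Finsupp.smul_apply, repr_graphVec, if_pos rfl,
            ha j j (by omega)]
          simp
        · intro k _ hk
          split_ifs
          · rw [map_smul, Finsupp.smul_apply, repr_graphVec, if_neg hk, ha k j (by omega)]
            simp
          · simp
        · simp
    rw [this]
    refine Submodule.sum_mem _ fun k _ => ?_
    split_ifs with hk
    · exact Submodule.smul_mem _ _ (graphVec_mem hk)
    · exact zero_mem _

lemma finrank_graphSpan (ha : ∀ i j, ¬ (p ≤ d i ∧ d j < p) → a i j = 0) :
    Module.finrank ℂ (graphSpan e d a p) = Fintype.card {i // p ≤ d i} := by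
  refine finrank_span_eq_card ?_
  rw [Fintype.linearIndependent_iff]
  intro c hc i
  have h1 := congrArg (fun v => e.repr v i) hc
  simp only [map_sum, map_smul, Finsupp.coe_finsetSum, Finset.sum_apply, Finsupp.smul_apply,
    repr_graphVec, map_zero, Finsupp.coe_zero, Pi.zero_apply] at h1
  rw [Finset.sum_eq_single i] at h1
  · have := i.2
    rw [ha i i (by omega)] at h1
    simpa using h1
  · intro k _ hk
    have := i.2
    rw [ha k i (by omega), if_neg fun h => hk (Subtype.ext h)]
    simp
  · simp

end Graphs

/-! ### Decreasing chains of graphs and their leading vectors. -/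

section Chains

variable {W : Type*} [AddCommGroup W] [Module ℂ W] {I : Type*} [Fintype I] [DecidableEq I]
  {e : Module.Basis I ℂ W} {d : I → ℕ} {a : ℕ → I → I → ℂ}

/-- Each generator of the smaller graph is tested with `mem_graphSpan_iff`. In the quadratic term
only the `k` with `d k = p` contribute. -/
lemma graphSpan_succ_le_iff (ha : ∀ p i j, ¬ (p ≤ d i ∧ d j < p) → a p i j = 0) {p : ℕ} :
    graphSpan e d (a (p + 1)) (p + 1) ≤ graphSpan e d (a p) p ↔
      ∀ i j, p + 1 ≤ d i → d j < p →
        a (p + 1) i j - a p i j - ∑ k, a (p + 1) i k * a p k j = 0 := by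
  have key : ∀ i j, p + 1 ≤ d i → d j < p →
      (e.repr (graphVec e (a (p + 1)) i) j =
        ∑ k, e.repr (graphVec e (a (p + 1)) i) k * a p k j ↔
        a (p + 1) i j - a p i j - ∑ k, a (p + 1) i k * a p k j = 0) := by
    intro i j hi hj
    simp only [repr_graphVec, add_mul, Finset.sum_add_distrib, ite_mul, one_mul, zero_mul,
      Finset.sum_ite_eq, Finset.mem_univ, if_true]
    rw [if_neg (by rintro rfl; omega), zero_add, sub_sub, sub_eq_zero]
  constructor
  · intro hle i j hi hj
    exact (key i j hi hj).1 ((mem_graphSpan_iff (ha p)).1 (hle (graphVec_mem hi)) j hj)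
  · intro h
    rw [graphSpan, Submodule.span_le]
    rintro _ ⟨⟨i, hi⟩, rfl⟩
    exact (mem_graphSpan_iff (ha p)).2 fun j hj => (key i j hi hj).2 (h i j hi hj)

/-- For a decreasing chain of graphs, the `p`-th member is spanned by the leading vectors. -/
lemma graphSpan_le_span (ha : ∀ p i j, ¬ (p ≤ d i ∧ d j < p) → a p i j = 0) {n : ℕ}
    (hd : ∀ i, d i ≤ n)
    (hle : ∀ p, graphSpan e d (a (p + 1)) (p + 1) ≤ graphSpan e d (a p) p) (p : ℕ) :
    graphSpan e d (a p) p ≤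
      Submodule.span ℂ (Set.range fun i : {i // p ≤ d i} => graphVec e (a (d i)) i) := by
  induction p using step_induction (n := n) with
  | hgt p hp =>
    rw [graphSpan, Submodule.span_le]
    rintro _ ⟨⟨i, hi⟩, rfl⟩
    have := hd i
    omega
  | hle p hp ih =>
    have hmono : Submodule.span ℂ
        (Set.range fun i : {i // p + 1 ≤ d i} => graphVec e (a (d i)) i) ≤
        Submodule.span ℂ (Set.range fun i : {i // p ≤ d i} => graphVec e (a (d i)) i) := by
      refine Submodule.span_mono ?_
      rintro _ ⟨⟨i, hi⟩, rfl⟩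
      exact ⟨⟨i, (Nat.le_succ p).trans hi⟩, rfl⟩
    have hlead : ∀ k, d k = p → graphVec e (a p) k ∈
        Submodule.span ℂ (Set.range fun i : {i // p ≤ d i} => graphVec e (a (d i)) i) :=
      fun k hk => Submodule.subset_span ⟨⟨k, hk.ge⟩, by simp [hk]⟩
    rw [graphSpan, Submodule.span_le]
    rintro _ ⟨⟨i, hi⟩, rfl⟩
    rcases hi.eq_or_lt with hi' | hi'
    · exact hlead i hi'.symm
    -- The difference of the vectors of index `i` in the graphs `p + 1` and `p` lies in the `p`-th
    -- graph and has no component of degree above `p`, so it is a combination of leading vectors of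
    -- degree exactly `p`.
    · have hv := hle p (graphVec_mem (e := e) hi')
      have hu := eq_sum_of_mem_graphSpan (ha p) (sub_mem hv (graphVec_mem hi))
      have hu' : graphVec e (a (p + 1)) i - graphVec e (a p) i ∈
          Submodule.span ℂ (Set.range fun i : {i // p ≤ d i} => graphVec e (a (d i)) i) := by
        rw [hu]
        refine Submodule.sum_mem _ fun k _ => ?_
        split_ifs with hk
        · rcases hk.eq_or_lt with hk' | hk'
          · exact Submodule.smul_mem _ _ (hlead k hk'.symm)
          · rw [map_sub, Finsupp.sub_apply, repr_graphVec, repr_graphVec,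
              ha (p + 1) i k (by omega), ha p i k (by omega), sub_self, zero_smul]
            exact zero_mem _
        · exact zero_mem _
      have := sub_mem (hmono (ih (graphVec_mem hi'))) hu'
      simpa using this

end Chains

/-! ### The affine chart defined by a single graded basis. -/

section GradedChart

variable {W : Type*} [AddCommGroup W] [Module ℂ W] {I : Type*} [Fintype I]
  {e : Module.Basis I ℂ W} {d : I → ℕ} {n : ℕ} {x : Family W n}

/-- The affine chart given by a basis which is adapted to all members of the family. -/
noncomputable def gradedChart (e : Module.Basis I ℂ W) (d : I → ℕ)
    (hx : ∀ p : Fin (n + 1),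
      Submodule.span ℂ (Set.range fun i : {i // (p : ℕ) ≤ d i} => e i) = x p) :
    AffineChart x where
  k p := Fintype.card {i // (p : ℕ) ≤ d i}
  l p := Fintype.card {i // ¬ (p : ℕ) ≤ d i}
  basis p := e.reindex ((Equiv.sumCompl fun i => (p : ℕ) ≤ d i).symm.trans
    (Equiv.sumCongr (Fintype.equivFin _) (Fintype.equivFin _)))
  span_eq p := by
    rw [← hx p]
    congr 1
    ext v
    constructor
    · rintro ⟨i, rfl⟩
      exact ⟨(Fintype.equivFin _).symm i, by simp⟩
    · rintro ⟨i, rfl⟩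
      exact ⟨Fintype.equivFin _ i, by simp⟩

variable (hx : ∀ p : Fin (n + 1),
      Submodule.span ℂ (Set.range fun i : {i // (p : ℕ) ≤ d i} => e i) = x p)

/-- The affine coordinates in a graded chart, indexed by the basis and extended by zero. -/
noncomputable def gradedCoord (p : ℕ) (i j : I) : (gradedChart e d hx).Coord →ₗ[ℂ] ℂ :=
  if h : p < n + 1 ∧ p ≤ d i ∧ ¬ p ≤ d j then
    LinearMap.proj (Fintype.equivFin {j // ¬ p ≤ d j} ⟨j, h.2.2⟩) ∘ₗ
      LinearMap.proj (Fintype.equivFin {i // p ≤ d i} ⟨i, h.2.1⟩) ∘ₗ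
        (LinearMap.proj (⟨p, h.1⟩ : Fin (n + 1)) :
          (gradedChart e d hx).Coord →ₗ[ℂ]
            (Fin (Fintype.card {i // p ≤ d i}) → Fin (Fintype.card {j // ¬ p ≤ d j}) → ℂ))
  else 0

lemma gradedCoord_eq_zero {p : ℕ} {i j : I} (h : ¬ (p ≤ d i ∧ d j < p))
    (z : (gradedChart e d hx).Coord) : gradedCoord hx p i j z = 0 := by
  rw [gradedCoord, dif_neg (by omega), LinearMap.zero_apply]

lemma exists_gradedCoord_eq (hd : ∀ i, d i ≤ n) (f : ℕ → I → I → ℂ) :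
    ∃ z, ∀ p i j, p ≤ d i → d j < p → gradedCoord hx p i j z = f p i j := by
  refine ⟨fun p r c => f p ((Fintype.equivFin {i // (p : ℕ) ≤ d i}).symm r)
    ((Fintype.equivFin {i // ¬ (p : ℕ) ≤ d i}).symm c), fun p i j hi hj => ?_⟩
  have := hd i
  rw [gradedCoord, dif_pos ⟨by omega, hi, by omega⟩]
  show f p ((Fintype.equivFin {i // p ≤ d i}).symm (Fintype.equivFin {i // p ≤ d i} ⟨i, hi⟩))
    ((Fintype.equivFin {i // ¬ p ≤ d i}).symm (Fintype.equivFin {i // ¬ p ≤ d i} ⟨j, _⟩)) = _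
  rw [Equiv.symm_apply_apply, Equiv.symm_apply_apply]

lemma gradedChart_basis_inl (p : Fin (n + 1)) (i : {i // (p : ℕ) ≤ d i}) :
    (gradedChart e d hx).basis p (Sum.inl (Fintype.equivFin {i // (p : ℕ) ≤ d i} i)) = e i := by
  have h1 : ((Equiv.sumCompl fun i => (p : ℕ) ≤ d i).symm.trans
      (Equiv.sumCongr (Fintype.equivFin _) (Fintype.equivFin _))) (i : I) =
        Sum.inl (Fintype.equivFin {i // (p : ℕ) ≤ d i} i) := by simp
  exact (Module.Basis.reindex_apply _ _ _).trans (congrArg e ((Equiv.symm_apply_eq _).2 h1.symm))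

lemma gradedChart_basis_inr (p : Fin (n + 1)) (i : {i // ¬ (p : ℕ) ≤ d i}) :
    (gradedChart e d hx).basis p (Sum.inr (Fintype.equivFin {i // ¬ (p : ℕ) ≤ d i} i)) = e i := by
  have h1 : ((Equiv.sumCompl fun i => (p : ℕ) ≤ d i).symm.trans
      (Equiv.sumCongr (Fintype.equivFin _) (Fintype.equivFin _))) (i : I) =
        Sum.inr (Fintype.equivFin {i // ¬ (p : ℕ) ≤ d i} i) := by simp
  exact (Module.Basis.reindex_apply _ _ _).trans (congrArg e ((Equiv.symm_apply_eq _).2 h1.symm))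

lemma step_gradedChart_param {n : ℕ} {V : Type*} [AddCommGroup V] [Module ℝ V]
    {x : Family (ℂ ⊗[ℝ] V) n} {e : Module.Basis I ℂ (ℂ ⊗[ℝ] V)}
    (hx : ∀ p : Fin (n + 1),
      Submodule.span ℂ (Set.range fun i : {i // (p : ℕ) ≤ d i} => e i) = x p)
    (hd : ∀ i, d i ≤ n) (z : (gradedChart e d hx).Coord) (p : ℕ) :
    step ((gradedChart e d hx).param z) p =
      graphSpan e d (fun i j => gradedCoord hx p i j z) p := by
  by_cases hp : p < n + 1
  · rw [step_of_lt hp]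
    show Submodule.span ℂ (Set.range fun r : Fin (Fintype.card {i // p ≤ d i}) => _) = _
    have key : ∀ i : {i // p ≤ d i},
        graphVec e (fun i j => gradedCoord hx p i j z) i =
        (gradedChart e d hx).basis ⟨p, hp⟩ (Sum.inl (Fintype.equivFin {i // p ≤ d i} i)) +
        ∑ c : Fin (Fintype.card {i // ¬ p ≤ d i}),
          z ⟨p, hp⟩ (Fintype.equivFin {i // p ≤ d i} i) c •
            (gradedChart e d hx).basis ⟨p, hp⟩ (Sum.inr c) := by
      intro i
      rw [graphVec]
      congr 1
      · exact (gradedChart_basis_inl hx ⟨p, hp⟩ i).symm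
      · rw [← (Equiv.sumCompl fun i => p ≤ d i).sum_comp, Fintype.sum_sum_type,
          Finset.sum_eq_zero, zero_add, ← (Fintype.equivFin {i // ¬ p ≤ d i}).sum_comp]
        · refine Finset.sum_congr rfl fun j _ => ?_
          refine congrArg₂ (· • ·) ?_ (gradedChart_basis_inr hx ⟨p, hp⟩ j).symm
          exact LinearMap.congr_fun (dif_pos (⟨hp, i.2, j.2⟩ :
            p < n + 1 ∧ p ≤ d (i : I) ∧ ¬ p ≤ d (j : I))) z
        · intro k _
          have := k.2
          rw [Equiv.sumCompl_apply_inl, gradedCoord_eq_zero hx (fun h => not_lt.2 this h.2),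
            zero_smul]
    rw [graphSpan]
    congr 1
    ext v
    constructor
    · rintro ⟨r, rfl⟩
      obtain ⟨i, rfl⟩ := (Fintype.equivFin {i // p ≤ d i}).surjective r
      exact ⟨i, key i⟩
    · rintro ⟨i, rfl⟩
      exact ⟨Fintype.equivFin _ i, (key i).symm⟩
  · rw [step_of_gt (by omega), eq_comm, eq_bot_iff, graphSpan, Submodule.span_le]
    rintro _ ⟨⟨i, hi⟩, rfl⟩
    have := hd i
    omega

end GradedChart

/-! ### Stability of signs under small perturbations. -/

section Estimates

variable {I : Type*} [Fintype I]

lemma norm_sum_sum_le (x y : I → ℂ) {E : I → I → ℂ} {δ : ℝ} (hE : ∀ i k, ‖E i k‖ ≤ δ) :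
    ‖∑ i, ∑ k, x i * y k * E i k‖ ≤ δ * ((∑ i, ‖x i‖) * ∑ k, ‖y k‖) := by
  rw [Finset.sum_mul_sum, Finset.mul_sum]
  refine (norm_sum_le _ _).trans (Finset.sum_le_sum fun i _ => ?_)
  rw [Finset.mul_sum]
  refine (norm_sum_le _ _).trans (Finset.sum_le_sum fun k _ => ?_)
  rw [norm_mul, norm_mul, mul_comm]
  exact mul_le_mul_of_nonneg_right (hE i k) (by positivity)

lemma sq_sum_norm_le (x : I → ℂ) :
    (∑ i, ‖x i‖) ^ 2 ≤ Fintype.card I * ∑ i, ‖x i‖ ^ 2 := by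
  simpa using sq_sum_le_card_mul_sum_sq (s := Finset.univ) (f := fun i => ‖x i‖)

/-- Let `M`, `M'` be small perturbations of a diagonal matrix with entries `±1`. A vector which is
`M'`-orthogonal to the coordinate directions in `t`, and supported on `t` and on directions of
sign `σ`, has `M`-square of sign `σ`. -/
lemma pos_of_close [DecidableEq I] {c : I → ℂ} (hc : c ≠ 0) {ε : I → ℝ} (hε : ∀ i, ε i * ε i = 1)
    {σ : ℝ} (hσ : σ * σ = 1) (t : I → Prop) [DecidablePred t]
    (hσε : ∀ i, c i ≠ 0 → ¬ t i → ε i = σ) {M M' : I → I → ℂ} {δ : ℝ}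
    (hδ : 3 * (δ * Fintype.card I) < 1)
    (hM : ∀ i k, ‖M i k - if i = k then (ε i : ℂ) else 0‖ ≤ δ)
    (hM' : ∀ i k, ‖M' i k - if i = k then (ε i : ℂ) else 0‖ ≤ δ)
    (horth : ∀ k, t k → ∑ i, starRingEnd ℂ (c i) * M' k i = 0) :
    0 < σ * (∑ i, ∑ k, c i * starRingEnd ℂ (c k) * M i k).re := by
  have hδ0 : 0 ≤ δ := by
    by_contra h0
    obtain ⟨i, -⟩ := Function.ne_iff.1 hc
    exact h0 ((norm_nonneg _).trans (hM i i))
  set R : ℝ := ∑ i, ‖c i‖ ^ 2 with hR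
  have hRpos : 0 < R := by
    obtain ⟨i, hi⟩ := Function.ne_iff.1 hc
    exact Finset.sum_pos' (fun i _ => by positivity)
      ⟨i, Finset.mem_univ _, by have : c i ≠ 0 := hi; positivity⟩
  have hbound : (∑ i, ‖c i‖) * ∑ i, ‖c i‖ ≤ Fintype.card I * R := by
    rw [← sq]; exact sq_sum_norm_le c
  have hnsq : ∀ i, starRingEnd ℂ (c i) * c i = ((‖c i‖ ^ 2 : ℝ) : ℂ) := fun i => by
    rw [mul_comm, Complex.mul_conj, Complex.normSq_eq_norm_sq]
  have hσ1 : |σ| = 1 := by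
    rcases mul_self_eq_one_iff.1 hσ with rfl | rfl <;> simp
  have hε1 : ∀ i, |ε i| = 1 := fun i => by
    rcases mul_self_eq_one_iff.1 (hε i) with h | h <;> simp [h]
  -- the components in the directions of `t` are small
  have hsmall : (∑ k, if t k then ‖c k‖ ^ 2 else 0) ≤ δ * (Fintype.card I * R) := by
    -- The factor `ε k` is chosen so that the diagonal part of the pairing is the sum of `‖c k‖ ^ 2`
    -- over `t`; the full pairing vanishes by `horth`.
    let y : I → ℂ := fun k => if t k then (ε k : ℂ) * c k else 0
    have h1 : ∑ k, ∑ i, y k * starRingEnd ℂ (c i) * M' k i = 0 := by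
      refine Finset.sum_eq_zero fun k _ => ?_
      by_cases hk : t k
      · simp only [mul_assoc]
        rw [← Finset.mul_sum, horth k hk, mul_zero]
      · simp [y, hk]
    have h2 : ∑ k, ∑ i, y k * starRingEnd ℂ (c i) * (if k = i then (ε k : ℂ) else 0) =
        ((∑ k, if t k then ‖c k‖ ^ 2 else 0 : ℝ) : ℂ) := by
      rw [Complex.ofReal_sum]
      refine Finset.sum_congr rfl fun k _ => ?_
      simp only [mul_ite, mul_zero, Finset.sum_ite_eq, Finset.mem_univ, if_true, y]
      split_ifs
      · rw [← hnsq]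
        have : (ε k : ℂ) * ε k = 1 := by exact_mod_cast hε k
        linear_combination starRingEnd ℂ (c k) * c k * this
      · simp
    have h3 := norm_sum_sum_le y (fun i => starRingEnd ℂ (c i)) hM'
    simp only [mul_sub, Finset.sum_sub_distrib] at h3
    rw [h1, h2, zero_sub, norm_neg, Complex.norm_real, Real.norm_eq_abs] at h3
    refine (le_abs_self _).trans (h3.trans (mul_le_mul_of_nonneg_left (le_trans ?_ hbound) hδ0))
    refine mul_le_mul (Finset.sum_le_sum fun k _ => ?_)
      (Finset.sum_le_sum fun k _ => by simp) (by positivity) (by positivity)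
    by_cases hk : t k
    · simp [y, hk, hε1]
    · simp [y, hk]
  have h1 : ∑ i, ∑ k, c i * starRingEnd ℂ (c k) * (if i = k then (ε i : ℂ) else 0) =
      ((∑ i, ε i * ‖c i‖ ^ 2 : ℝ) : ℂ) := by
    rw [Complex.ofReal_sum]
    refine Finset.sum_congr rfl fun i _ => ?_
    simp only [mul_ite, mul_zero, Finset.sum_ite_eq, Finset.mem_univ, if_true]
    rw [Complex.ofReal_mul, ← hnsq]
    ring
  have h2 := norm_sum_sum_le c (fun i => starRingEnd ℂ (c i)) hM
  simp only [mul_sub, Finset.sum_sub_distrib] at h2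
  rw [h1] at h2
  set S := ∑ i, ∑ k, c i * starRingEnd ℂ (c k) * M i k with hS
  have h3 : |S.re - ∑ i, ε i * ‖c i‖ ^ 2| ≤ δ * (Fintype.card I * R) := by
    have := (Complex.abs_re_le_norm _).trans h2
    rw [Complex.sub_re, Complex.ofReal_re] at this
    refine this.trans (mul_le_mul_of_nonneg_left (le_trans (le_of_eq ?_) hbound) hδ0)
    simp
  -- Off `t` the product `σ * ε i` is `1`; on `t` it is at least `-1`, a loss of at most `2 ‖c i‖ ^
  -- 2`.
  have h4 : R - 2 * (∑ k, if t k then ‖c k‖ ^ 2 else 0) ≤ σ * ∑ i, ε i * ‖c i‖ ^ 2 := by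
    rw [hR, Finset.mul_sum, Finset.mul_sum, ← Finset.sum_sub_distrib]
    refine Finset.sum_le_sum fun i _ => ?_
    by_cases hi : c i = 0
    · simp [hi]
    by_cases ht : t i
    · simp only [ht, if_true]
      have : -1 ≤ σ * ε i := by
        have := abs_mul σ (ε i)
        rw [hσ1, hε1, mul_one] at this
        exact (abs_le.1 this.le).1
      nlinarith [sq_nonneg ‖c i‖]
    · rw [hσε i hi ht, ← mul_assoc, hσ]
      simp [ht]
  have h5 : σ * ∑ i, ε i * ‖c i‖ ^ 2 - δ * (Fintype.card I * R) ≤ σ * S.re := by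
    have h6 : |σ * (S.re - ∑ i, ε i * ‖c i‖ ^ 2)| ≤ δ * (Fintype.card I * R) := by
      rwa [abs_mul, hσ1, one_mul]
    have := (abs_le.1 h6).1
    rw [mul_sub] at this
    linarith
  -- The total loss is at most `3 δ · card I · R`, which is less than `R` by `hδ`.
  nlinarith

end Estimates

/-! ### Openness of surjectivity of the derivative. -/

section Derivatives

variable {E G : Type*} [NormedAddCommGroup E] [NormedSpace ℂ E] [NormedAddCommGroup G]
  [NormedSpace ℂ G]

/-- Surjectivity of the derivative onto a finite-dimensional space is an open condition. -/
lemma eventually_surjective_fderiv [FiniteDimensional ℂ G] {f : E → G} (hf : ContDiff ℂ 1 f)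
    {x : E} (hx : Function.Surjective (fderiv ℂ f x)) :
    ∀ᶠ z in 𝓝 x, Function.Surjective (fderiv ℂ f z) := by
  obtain ⟨s, hs⟩ := (fderiv ℂ f x).toLinearMap.exists_rightInverse_of_surjective
    (LinearMap.range_eq_top.2 hx)
  let s' : G →L[ℂ] E := LinearMap.toContinuousLinearMap s
  -- After composition with a right inverse of the derivative at `x` one gets a continuous family
  -- equal to the identity at `x`; invertible operators form an open set.
  have hcont : Continuous fun z => (fderiv ℂ f z).comp s' :=
    (hf.continuous_fderiv one_ne_zero).clm_comp continuous_const
  have hone : (fderiv ℂ f x).comp s' = ContinuousLinearMap.id ℂ G := by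
    ext v
    exact LinearMap.congr_fun hs v
  have := FiniteDimensional.complete ℂ G
  have hnhds : Set.range ((↑) : (G ≃L[ℂ] G) → G →L[ℂ] G) ∈ 𝓝 ((fderiv ℂ f x).comp s') := by
    rw [hone]
    exact ContinuousLinearEquiv.nhds (ContinuousLinearEquiv.refl ℂ G)
  filter_upwards [hcont.continuousAt.preimage_mem_nhds hnhds] with z hz
  obtain ⟨T, hT⟩ := hz
  intro v
  refine ⟨s' (T.symm v), ?_⟩
  have h1 := congrArg (fun A : G →L[ℂ] G => A (T.symm v)) hT
  simpa using h1.symm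

lemma hasFDerivAt_mul_of_affine (L L' : E →L[ℂ] ℂ) (a b : ℂ) :
    HasFDerivAt (fun z => (a + L z) * (b + L' z)) (a • L' + b • L) 0 := by
  have h := (L.hasFDerivAt (x := 0).const_add a).fun_mul (L'.hasFDerivAt (x := 0).const_add b)
  simpa using h

end Derivatives

/-! ### Local equations and independence of their linear parts. -/

section Equations

variable {m : ℕ} {h : ℕ → ℕ} {E : Type*} [NormedAddCommGroup E] [NormedSpace ℂ E]
  (L : ℕ → HodgeIndex m h → HodgeIndex m h → E →L[ℂ] ℂ)

/-- The indices of the equations which say that a family of graphs is decreasing. -/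
abbrev ChainIndex (m : ℕ) (h : ℕ → ℕ) : Type :=
  {t : Fin (2 * m) × HodgeIndex m h × HodgeIndex m h //
    (t.1 : ℕ) + 1 ≤ deg t.2.1 ∧ deg t.2.2 < (t.1 : ℕ)}

/-- A choice of representatives of the unordered pairs `{i, k}` with `deg i + deg k > 2m`. -/
def IsLeadingPair (i k : HodgeIndex m h) : Prop :=
  2 * m < deg i + deg k ∧
    (deg k < deg i ∨ deg k = deg i ∧ Fintype.equivFin _ k ≤ Fintype.equivFin _ i)

/-- The indices of the equations which express the first Hodge–Riemann relation. -/
abbrev PairIndex (m : ℕ) (h : ℕ → ℕ) : Type :=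
  {t : HodgeIndex m h × HodgeIndex m h // IsLeadingPair t.1 t.2}

/-- The left-hand side of the equation `Q (v i, v k) = 0` for the leading vectors `v` of a chain of
graphs with coordinate functions `L`. -/
noncomputable def pairEquation (i k : HodgeIndex m h) (z : E) : ℂ :=
  ∑ j, (sgn j : ℂ) * (((if i = j then 1 else 0) + L (deg i) i j z) *
    ((if k = swap j then 1 else 0) + L (deg k) k (swap j) z))

/-- The local equations of the period domain. -/
noncomputable def equations (z : E) : ChainIndex m h ⊕ PairIndex m h → ℂ :=
  Sum.elim
    (fun t => L (t.1.1 + 1) t.1.2.1 t.1.2.2 z - L t.1.1 t.1.2.1 t.1.2.2 z -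
      ∑ k, L (t.1.1 + 1) t.1.2.1 k z * L t.1.1 k t.1.2.2 z)
    (fun t => pairEquation L t.1.1 t.1.2 z)

/-- The linear parts of the local equations of the period domain. -/
noncomputable def linearEquations : ChainIndex m h ⊕ PairIndex m h → E →L[ℂ] ℂ :=
  Sum.elim
    (fun t => L (t.1.1 + 1) t.1.2.1 t.1.2.2 - L t.1.1 t.1.2.1 t.1.2.2)
    (fun t => (sgn t.1.1 : ℂ) • L (deg t.1.2) t.1.2 (swap t.1.1) +
      (sgn t.1.2 : ℂ) • L (deg t.1.1) t.1.1 (swap t.1.2))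

lemma equations_eq_zero_iff {z : E} : (∀ t, equations L z t = 0) ↔
    (∀ p i j, p + 1 ≤ deg i → deg j < p →
      L (p + 1) i j z - L p i j z - ∑ k, L (p + 1) i k z * L p k j z = 0) ∧
    ∀ i k, IsLeadingPair i k → pairEquation L i k z = 0 := by
  constructor
  · intro H
    refine ⟨fun p i j hi hj => ?_, fun i k hik => H (Sum.inr ⟨(i, k), hik⟩)⟩
    have := deg_le i
    exact H (Sum.inl ⟨(⟨p, by omega⟩, i, j), hi, hj⟩)
  · rintro ⟨H, H'⟩ (⟨⟨p, i, j⟩, hi, hj⟩ | ⟨⟨i, k⟩, hik⟩)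
    · exact H p i j hi hj
    · exact H' i k hik

lemma contDiff_equations (t : ChainIndex m h ⊕ PairIndex m h) :
    ContDiff ℂ 1 fun z => equations L z t := by
  rcases t with t | t
  · simp only [equations, Sum.elim_inl]
    fun_prop
  · simp only [equations, Sum.elim_inr, pairEquation]
    fun_prop

lemma hasFDerivAt_equations (t : ChainIndex m h ⊕ PairIndex m h) :
    HasFDerivAt (fun z => equations L z t) (linearEquations L t) 0 := by
  rcases t with ⟨⟨p, i, j⟩, ht⟩ | ⟨⟨i, k⟩, ht⟩
  · have h1 := ((L (p + 1) i j).hasFDerivAt (x := 0)).fun_sub ((L p i j).hasFDerivAt (x := 0))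
    have h2 := h1.fun_sub (HasFDerivAt.fun_sum (u := Finset.univ) fun k _ =>
      hasFDerivAt_mul_of_affine (L (p + 1) i k) (L p k j) 0 0)
    have h3 : linearEquations L (Sum.inl ⟨(p, i, j), ht⟩) =
        L (p + 1) i j - L p i j -
          ∑ k, ((0 : ℂ) • L p k j + (0 : ℂ) • L (p + 1) i k) := by
      rw [Finset.sum_eq_zero fun k _ => by
        rw [zero_smul ℂ (L p k j), zero_smul ℂ (L (p + 1) i k), add_zero], sub_zero]
      rfl
    rw [h3]
    simpa only [equations, Sum.elim_inl, zero_add] using h2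
  · have h1 := HasFDerivAt.fun_sum (u := Finset.univ) fun j _ =>
      (hasFDerivAt_mul_of_affine (L (deg i) i j) (L (deg k) k (swap j))
        (if i = j then 1 else 0) (if k = swap j then 1 else 0)).const_mul (sgn j : ℂ)
    have h2 : linearEquations L (Sum.inr ⟨(i, k), ht⟩) =
        ∑ j, (sgn j : ℂ) • ((if i = j then (1 : ℂ) else 0) • L (deg k) k (swap j) +
          (if k = swap j then (1 : ℂ) else 0) • L (deg i) i j) := by
      simp only [smul_add, Finset.sum_add_distrib, linearEquations, Sum.elim_inr]
      congr 1
      · rw [Finset.sum_eq_single i]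
        · rw [if_pos rfl, one_smul]
        · intro j _ hj
          rw [if_neg hj.symm, zero_smul ℂ (L _ _ _), smul_zero]
        · exact fun hi => absurd (Finset.mem_univ _) hi
      · rw [Finset.sum_eq_single (swap k)]
        · rw [if_pos (swap_swap k).symm, one_smul, sgn_swap]
        · intro j _ hj
          rw [if_neg fun hk => hj (by rw [hk, swap_swap]), zero_smul ℂ (L _ _ _), smul_zero]
        · exact fun hi => absurd (Finset.mem_univ _) hi
    rw [h2]
    exact h1

lemma IsLeadingPair.not_symm {i k : HodgeIndex m h} (hik : IsLeadingPair i k) (hne : i ≠ k) :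
    ¬ IsLeadingPair k i := by
  rintro ⟨-, h1⟩
  obtain ⟨-, h2⟩ := hik
  apply hne
  apply (Fintype.equivFin (HodgeIndex m h)).injective
  rcases h1 with h1 | ⟨h1, h1'⟩ <;> rcases h2 with h2 | ⟨h2, h2'⟩
  · omega
  · omega
  · omega
  · exact le_antisymm h1' h2'

lemma isLeadingPair_total {i k : HodgeIndex m h} (hik : 2 * m < deg i + deg k) :
    IsLeadingPair i k ∨ IsLeadingPair k i := by
  rcases lt_trichotomy (deg i) (deg k) with h1 | h1 | h1
  · exact Or.inr ⟨by omega, Or.inl h1⟩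
  · rcases le_total (Fintype.equivFin _ k) (Fintype.equivFin _ i) with h2 | h2
    · exact Or.inl ⟨hik, Or.inr ⟨h1.symm, h2⟩⟩
    · exact Or.inr ⟨by omega, Or.inr ⟨h1, h2⟩⟩
  · exact Or.inl ⟨hik, Or.inl h1⟩

/-- The linear parts of the local equations of the period domain and of the further equations of
the Noether–Lefschetz locus are independent. -/
lemma exists_linearEquations_eq
    (hL : ∀ f : ℕ → HodgeIndex m h → HodgeIndex m h → ℂ,
      ∃ z, ∀ p i j, p ≤ deg i → deg j < p → L p i j z = f p i j)
    (k₀ : Fin (h m)) (y : ChainIndex m h ⊕ PairIndex m h → ℂ) (ω : HodgeIndex m h → ℂ) :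
    ∃ z, (∀ t, linearEquations L t z = y t) ∧
      ∀ i, m < deg i → L (deg i) i (Sum.inr k₀) z = ω i := by
  classical
  let α : ℕ → HodgeIndex m h → HodgeIndex m h → ℂ := fun p i j =>
    if ht : p < 2 * m ∧ p + 1 ≤ deg i ∧ deg j < p then
      y (Sum.inl ⟨(⟨p, ht.1⟩, i, j), ht.2⟩) else 0
  let β : HodgeIndex m h → HodgeIndex m h → ℂ := fun i k =>
    if ht : IsLeadingPair i k then y (Sum.inr ⟨(i, k), ht⟩) else 0
  let b : HodgeIndex m h → HodgeIndex m h → ℂ := fun i j => if j = Sum.inr k₀ then ω i else 0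
  -- `base i j` is the value of the leading coordinate `L (deg i) i j`. The equation of a leading
  -- pair `(i, k)` is solved for the coordinate `(k, swap i)`, leaving `(i, swap k)` free; for `i =
  -- k` the two coincide, whence the division by `2`.
  let base : HodgeIndex m h → HodgeIndex m h → ℂ := fun i j =>
    if IsLeadingPair (swap j) i then
      if swap j = i then (sgn i : ℂ) * β i i / 2
      else (sgn (swap j) : ℂ) * (β (swap j) i - sgn i * b (swap j) (swap i))
    else b i j
  -- The sum telescopes: consecutive values of `p` differ by `α p i j`, the prescribed chain
  -- equation, and the sum is empty at `p = deg i`.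
  obtain ⟨z, hz⟩ := hL fun p i j => base i j - ∑ r ∈ Finset.Ico p (deg i), α r i j
  have hz' : ∀ i j, deg j < deg i → L (deg i) i j z = base i j := by
    intro i j hij
    rw [hz (deg i) i j le_rfl hij]
    simp
  have hsq : ∀ i : HodgeIndex m h, (sgn i : ℂ) * sgn i = 1 := fun i => by
    exact_mod_cast sgn_mul_self i
  refine ⟨z, ?_, fun i hi => ?_⟩
  · rintro (⟨⟨⟨p, hp⟩, i, j⟩, hi, hj⟩ | ⟨⟨i, k⟩, ht⟩)
    · dsimp only at hi hj
      simp only [linearEquations, Sum.elim_inl, sub_apply]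
      rw [hz (p + 1) i j hi (by omega), hz p i j (by omega) hj,
        Finset.sum_eq_sum_Ico_succ_bot (by omega : p < deg i)]
      have : α p i j = y (Sum.inl ⟨(⟨p, hp⟩, i, j), hi, hj⟩) := dif_pos ⟨hp, hi, hj⟩
      rw [← this]
      ring
    · have hdi := deg_le i
      have hdk := deg_le k
      dsimp only at ht
      have hlt := ht.1
      have hβ : β i k = y (Sum.inr ⟨(i, k), ht⟩) := dif_pos ht
      simp only [linearEquations, Sum.elim_inr, add_apply,
        smul_apply, smul_eq_mul]
      rw [hz' k (swap i) (by rw [deg_swap]; omega), hz' i (swap k) (by rw [deg_swap]; omega), ← hβ]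
      by_cases hik : i = k
      · subst hik
        have h1 : base i (swap i) = (sgn i : ℂ) * β i i / 2 := by
          simp only [base, swap_swap, if_pos ht, if_true]
        rw [h1]
        linear_combination β i i * hsq i
      · have h1 : base k (swap i) = (sgn i : ℂ) * (β i k - sgn k * b i (swap k)) := by
          simp only [base, swap_swap, if_pos ht, if_neg hik]
        have h2 : base i (swap k) = b i (swap k) := by
          simp only [base, swap_swap, if_neg (ht.not_symm hik)]
        rw [h1, h2]
        linear_combination (β i k - sgn k * b i (swap k)) * hsq i
  · have hdeg : deg (Sum.inr k₀ : HodgeIndex m h) = m := rfl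
    rw [hz' i _ (by rw [hdeg]; exact hi)]
    -- The coordinate `(i, k₀)` is among the free ones, because in a leading pair the first index
    -- has the larger degree.
    have h1 : ¬ IsLeadingPair (swap (Sum.inr k₀ : HodgeIndex m h)) i := by
      rintro ⟨-, h2⟩
      rw [deg_swap, hdeg] at h2
      omega
    simp only [base, if_neg h1, b, if_true]

end Equations

/-! ### The period domain and the Noether–Lefschetz locus in a graph chart. -/

section LocalStructure

variable {V : Type*} [AddCommGroup V] [Module ℝ V] {Q : LinearMap.BilinForm ℝ V} {m : ℕ}
  {h : ℕ → ℕ} {x y : Family (ℂ ⊗[ℝ] V) (2 * m)}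
  {e : Module.Basis (HodgeIndex m h) ℂ (ℂ ⊗[ℝ] V)}
  {a : ℕ → HodgeIndex m h → HodgeIndex m h → ℂ}

lemma IsHodgeBasis.span_eq (he : IsHodgeBasis Q x e) (hx : IsPolarizedFlag Q h x)
    (p : Fin (2 * m + 1)) :
    Submodule.span ℂ (Set.range fun i : {i : HodgeIndex m h // (p : ℕ) ≤ deg i} => e i) = x p := by
  rw [show x p = step x p from (step_of_lt p.2).symm]
  apply le_antisymm
  · rw [Submodule.span_le]
    rintro _ ⟨⟨i, hi⟩, rfl⟩
    exact step_antitone hx.antitone hi (he.mem i).1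
  · intro v hv
    rw [← e.sum_repr v]
    refine Submodule.sum_mem _ fun i _ => ?_
    by_cases hi : deg i < p
    · rw [(he.mem_step_iff hx).1 hv i hi, zero_smul]
      exact zero_mem _
    · exact Submodule.smul_mem _ _ (Submodule.subset_span ⟨⟨i, not_lt.1 hi⟩, rfl⟩)

lemma IsHodgeBasis.baseChange_graphVec (he : IsHodgeBasis Q x e) (i k : HodgeIndex m h)
    (a b : HodgeIndex m h → HodgeIndex m h → ℂ) :
    Q.baseChange ℂ (graphVec e a i) (graphVec e b k) =
      ∑ j, (sgn j : ℂ) * (((if i = j then 1 else 0) + a i j) *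
        ((if k = swap j then 1 else 0) + b k (swap j))) := by
  rw [he.baseChange_eq_sum]
  simp only [repr_graphVec]

/-- A vector of the `p`-th graph has its free components in degrees `≥ p`. Orthogonality to the next
graph makes those of degree `> p` small, so the sign of degree `p` prevails (`pos_of_close`). The
bound reaches `2 * m + 1` because the graph after the last step also occurs. -/
lemma isPositive_of_graph
    (ha : ∀ p i j, ¬ (p ≤ deg i ∧ deg j < p) → a p i j = 0)
    (hy : ∀ p, step y p = graphSpan e deg (a p) p) {δ : ℝ}
    (hδ : 3 * (δ * Fintype.card (HodgeIndex m h)) < 1)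
    (hclose : ∀ p ≤ 2 * m + 1, ∀ q ≤ 2 * m + 1, ∀ i k,
      ‖herm Q (graphVec e (a p) i) (graphVec e (a q) k) -
        if i = k then (sgn i : ℂ) else 0‖ ≤ δ) : IsPositive Q y := by
  classical
  intro p hp u hu horth hu0
  rw [hy] at hu
  let c : HodgeIndex m h → ℂ := fun k => if p ≤ deg k then e.repr u k else 0
  have huc : u = ∑ k, c k • graphVec e (a p) k := by
    conv_lhs => rw [eq_sum_of_mem_graphSpan (ha p) hu]
    refine Finset.sum_congr rfl fun k _ => ?_
    simp only [c]
    split_ifs <;> simp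
  have hc : c ≠ 0 := by
    intro hc
    apply hu0
    rw [huc, hc]
    simp
  have huu : herm Q u u =
      ∑ i, ∑ k, c i * starRingEnd ℂ (c k) * herm Q (graphVec e (a p) i) (graphVec e (a p) k) := by
    conv_lhs => rw [huc]
    simp only [map_sum, LinearMap.sum_apply, map_smul, LinearMap.smul_apply, LinearMap.map_smulₛₗ,
      smul_eq_mul, Finset.mul_sum]
    rw [Finset.sum_comm]
    exact Finset.sum_congr rfl fun i _ => Finset.sum_congr rfl fun k _ => by ring
  rw [huu]
  refine pos_of_close hc (ε := sgn) sgn_mul_self (by rw [← mul_pow]; norm_num)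
    (fun k => p + 1 ≤ deg k) ?_ hδ (hclose p (by omega) p (by omega))
    (M' := fun k i => herm Q (graphVec e (a (p + 1)) k) (graphVec e (a p) i))
    (hclose (p + 1) (by omega) p (by omega)) ?_
  · intro i hi hi'
    have h1 : p ≤ deg i := by
      by_contra h0
      exact hi (if_neg h0)
    rw [sgn, show deg i = p by omega]
  · intro k hk
    have h1 := horth (graphVec e (a (p + 1)) k) (by rw [hy]; exact graphVec_mem hk)
    rw [huc] at h1
    simpa only [map_sum, LinearMap.map_smulₛₗ, smul_eq_mul] using h1

/-- Since leading vectors span every member of the chain, the first relation reduces to pairs of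
leading vectors with degrees adding up to more than `2 * m`, and by symmetry to one ordering of each
pair. -/
lemma isPolarizedFlag_of_graph (hs : Q.IsSymm) (he : IsHodgeBasis Q x e)
    (hx : IsPolarizedFlag Q h x)
    (ha : ∀ p i j, ¬ (p ≤ deg i ∧ deg j < p) → a p i j = 0)
    (hy : ∀ p, step y p = graphSpan e deg (a p) p)
    (hchain : ∀ p, graphSpan e deg (a (p + 1)) (p + 1) ≤ graphSpan e deg (a p) p)
    (hpair : ∀ i k, IsLeadingPair i k →
      Q.baseChange ℂ (graphVec e (a (deg i)) i) (graphVec e (a (deg k)) k) = 0)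
    (hpos : IsPositive Q y) : IsPolarizedFlag Q h y where
  antitone := by
    have h1 : Antitone (step y) := antitone_nat_of_succ_le fun p => by
      rw [hy, hy]
      exact hchain p
    intro p q hpq
    have h2 := h1 (show (p : ℕ) ≤ q from hpq)
    rwa [step_of_lt p.2, step_of_lt q.2] at h2
  zero_eq_top := by
    have h1 : step y 0 = ⊤ := by
      rw [hy, eq_top_iff]
      exact fun v _ => (mem_graphSpan_iff (ha 0)).2 fun j hj => absurd hj (Nat.not_lt_zero _)
    rwa [step_of_lt (Nat.succ_pos _)] at h1
  first := by
    have hpair' : ∀ i k, 2 * m < deg i + deg k →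
        Q.baseChange ℂ (graphVec e (a (deg i)) i) (graphVec e (a (deg k)) k) = 0 := by
      intro i k hik
      rcases isLeadingPair_total hik with h1 | h1
      · exact hpair i k h1
      · rw [baseChange_comm hs]
        exact hpair k i h1
    intro p hp u hu v hv
    rw [hy] at hu hv
    have hu' := graphSpan_le_span ha deg_le hchain p hu
    have hv' := graphSpan_le_span ha deg_le hchain _ hv
    clear hu hv
    induction hu' using Submodule.span_induction with
    | zero => simp
    | add u u' _ _ h1 h2 => rw [map_add, LinearMap.add_apply, h1, h2, add_zero]
    | smul c u _ h1 => rw [map_smul, LinearMap.smul_apply, h1, smul_zero]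
    | mem u hu =>
      obtain ⟨⟨i, hi⟩, rfl⟩ := hu
      induction hv' using Submodule.span_induction with
      | zero => simp
      | add u u' _ _ h1 h2 => rw [map_add, h1, h2, add_zero]
      | smul c u _ h1 => rw [map_smul, h1, smul_zero]
      | mem v hv =>
        obtain ⟨⟨k, hk⟩, rfl⟩ := hv
        exact hpair' i k (by omega)
  finrank := by
    intro p
    rw [← hx.finrank p, hy, finrank_graphSpan (ha p)]
    by_cases hp : p < 2 * m + 1
    · rw [step_of_lt hp, ← he.span_eq hx ⟨p, hp⟩]
      exact (finrank_span_eq_card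
        (e.linearIndependent.comp _ Subtype.val_injective)).symm
    · rw [step_of_gt (by omega), finrank_bot, Fintype.card_eq_zero_iff]
      refine ⟨fun i => ?_⟩
      have h1 := i.2
      have h2 := deg_le (i : HodgeIndex m h)
      omega
  positive := hpos

/-- Near a point of the period domain with Hodge basis `e`, the points of the period domain are the
decreasing families of graphs which satisfy the first Hodge–Riemann relation. -/
lemma mem_periodDomain_iff_of_graph [FiniteDimensional ℝ V] (hs : Q.IsSymm)
    (hx : x ∈ periodDomain Q (2 * m) h) (he : IsHodgeBasis Q x e)
    (ha : ∀ p i j, ¬ (p ≤ deg i ∧ deg j < p) → a p i j = 0)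
    (hy : ∀ p, step y p = graphSpan e deg (a p) p) (hpos : IsPositive Q y) :
    y ∈ periodDomain Q (2 * m) h ↔
      (∀ p i j, p + 1 ≤ deg i → deg j < p →
        a (p + 1) i j - a p i j - ∑ k, a (p + 1) i k * a p k j = 0) ∧
      ∀ i k, IsLeadingPair i k →
        Q.baseChange ℂ (graphVec e (a (deg i)) i) (graphVec e (a (deg k)) k) = 0 := by
  constructor
  · intro hyD
    have hP := isPolarizedFlag_of_mem hyD
    refine ⟨fun p => (graphSpan_succ_le_iff (e := e) ha).1 ?_, fun i k hik => ?_⟩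
    · rw [← hy, ← hy]
      exact step_antitone hP.antitone (Nat.le_succ p)
    · have hdi := deg_le i
      refine hP.first (deg i) (by omega) _ (by rw [hy]; exact graphVec_mem le_rfl) _ ?_
      have := hik.1
      refine step_antitone hP.antitone (by omega : 2 * m + 1 - deg i ≤ deg k) ?_
      rw [hy]
      exact graphVec_mem le_rfl
  · rintro ⟨hchain, hpair⟩
    exact mem_periodDomain hs (isPolarizedFlag_of_graph hs he (isPolarizedFlag_of_mem hx) ha hy
      (fun p => (graphSpan_succ_le_iff ha).2 (hchain p)) hpair hpos) hx

/-- The further equations of the Noether–Lefschetz locus inside the period domain. -/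
lemma mem_step_iff_of_graph [FiniteDimensional ℝ V]
    (he : IsHodgeBasis Q x e) (hyD : y ∈ periodDomain Q (2 * m) h)
    (ha : ∀ p i j, ¬ (p ≤ deg i ∧ deg j < p) → a p i j = 0)
    (hy : ∀ p, step y p = graphSpan e deg (a p) p) {u : ℂ ⊗[ℝ] V} {c : ℂ} (hc : c ≠ 0)
    {k₀ : Fin (h m)} (hu : u = c • e (Sum.inr k₀)) :
    u ∈ step y m ↔ ∀ i, m < deg i → a (deg i) i (Sum.inr k₀) = 0 := by
  have hP := isPolarizedFlag_of_mem hyD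
  -- `e (Sum.inr k₀)` is real, so `Q` against it is the hermitian pairing, which reads off the
  -- coordinate of index `k₀`.
  have hQ : ∀ i, m < deg i → (Q.baseChange ℂ (graphVec e (a (deg i)) i) u = 0 ↔
      a (deg i) i (Sum.inr k₀) = 0) := by
    intro i hi
    have h1 : (sgn (Sum.inr k₀ : HodgeIndex m h) : ℂ) ≠ 0 := by exact_mod_cast sgn_ne_zero _
    have h2 : conj (e (Sum.inr k₀)) = e (Sum.inr k₀) := he.conj_apply _
    rw [hu, map_smul, smul_eq_mul, mul_eq_zero, or_iff_right hc, ← h2, ← herm_apply,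
      he.herm_basis_right, mul_eq_zero, or_iff_right h1, repr_graphVec, if_neg, zero_add]
    rintro rfl
    exact lt_irrefl _ hi
  constructor
  · intro hu' i hi
    rw [← hQ i hi]
    refine hP.first (m + 1) (by omega) _ ?_ _ ?_
    · refine step_antitone hP.antitone (show m + 1 ≤ deg i from hi) ?_
      rw [hy]
      exact graphVec_mem le_rfl
    · rwa [show 2 * m + 1 - (m + 1) = m by omega]
  · intro hw
    suffices h1 : u ∈ step y (2 * m + 1 - (m + 1)) by
      rwa [show 2 * m + 1 - (m + 1) = m by omega] at h1
    -- Orthogonality to `F^{m+1}` suffices for membership in `F^m`, and it need only be checked on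
    -- leading vectors.
    refine hyD.1.mem_step_of_orthogonal (by omega) fun v hv => ?_
    rw [hy] at hv
    have hv' := graphSpan_le_span ha deg_le (fun p => by
      rw [← hy, ← hy]
      exact step_antitone hP.antitone (Nat.le_succ p)) _ hv
    clear hv
    induction hv' using Submodule.span_induction with
    | zero => simp
    | add v v' _ _ h1 h2 => rw [map_add, LinearMap.add_apply, h1, h2, add_zero]
    | smul c v _ h1 => rw [map_smul, LinearMap.smul_apply, h1, smul_zero]
    | mem v hv =>
      obtain ⟨⟨i, hi⟩, rfl⟩ := hv
      exact (hQ i hi).2 (hw i hi)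

end LocalStructure

/-! ### The submanifold structure and the codimension. -/

section Submanifold

variable {V : Type*} [AddCommGroup V] [Module ℝ V] {Q : LinearMap.BilinForm ℝ V} {m : ℕ}
  {h : ℕ → ℕ} {x : Family (ℂ ⊗[ℝ] V) (2 * m)}
  {e : Module.Basis (HodgeIndex m h) ℂ (ℂ ⊗[ℝ] V)}

/-- The Gram matrix of the hermitian form in the vectors of a graph is close to that in the Hodge
basis. -/
lemma eventually_herm_graphVec_close {E : Type*} [NormedAddCommGroup E] [NormedSpace ℂ E]
    (he : IsHodgeBasis Q x e) (L : ℕ → HodgeIndex m h → HodgeIndex m h → E →L[ℂ] ℂ) {δ : ℝ}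
    (hδ : 0 < δ) (N : ℕ) : ∀ᶠ z in 𝓝 (0 : E), ∀ p ≤ N, ∀ q ≤ N, ∀ i k,
      ‖herm Q (graphVec e (fun i j => L p i j z) i) (graphVec e (fun i j => L q i j z) k) -
        if i = k then (sgn i : ℂ) else 0‖ ≤ δ := by
  have key : ∀ p q i k, ∀ᶠ z in 𝓝 (0 : E),
      ‖herm Q (graphVec e (fun i j => L p i j z) i) (graphVec e (fun i j => L q i j z) k) -
        if i = k then (sgn i : ℂ) else 0‖ ≤ δ := by
    intro p q i k
    have hcont : Continuous fun z =>
        ‖herm Q (graphVec e (fun i j => L p i j z) i) (graphVec e (fun i j => L q i j z) k) -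
          if i = k then (sgn i : ℂ) else 0‖ := by
      simp only [he.herm_eq_sum, repr_graphVec, starRingEnd_apply]
      fun_prop
    have hzero : ‖herm Q (graphVec e (fun i j => L p i j 0) i)
        (graphVec e (fun i j => L q i j 0) k) - if i = k then (sgn i : ℂ) else 0‖ = 0 := by
      simp [graphVec, he.herm_apply]
    exact (hcont.continuousAt.eventually_lt continuousAt_const (by rw [hzero]; exact hδ)).mono
      fun z hz => hz.le
  have hfin : ∀ᶠ z in 𝓝 (0 : E), ∀ p q : Fin (N + 1), ∀ i k,
      ‖herm Q (graphVec e (fun i j => L p i j z) i) (graphVec e (fun i j => L q i j z) k) -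
        if i = k then (sgn i : ℂ) else 0‖ ≤ δ := by
    simp only [Filter.eventually_all]
    exact fun p q i k => key p q i k
  filter_upwards [hfin] with z hz p hp q hq
  exact hz ⟨p, by omega⟩ ⟨q, by omega⟩

lemma card_upper : Fintype.card (Σ r : Fin m, Fin (h (m + 1 + r))) =
    ∑ p ∈ Finset.Icc (m + 1) (2 * m), h p := by
  rw [Fintype.card_sigma, ← Finset.Ico_succ_right_eq_Icc, Finset.sum_Ico_eq_sum_range,
    show Order.succ (2 * m) - (m + 1) = m by simp; omega, Finset.sum_range]
  simp

lemma forall_deg_gt_iff {P : HodgeIndex m h → Prop} :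
    (∀ i, m < deg i → P i) ↔ ∀ t, P (Sum.inl (Sum.inl t)) := by
  constructor
  · intro H t
    refine H _ ?_
    simp only [deg, Sum.elim_inl]
    omega
  · rintro H ((t | t) | t) ht
    · exact H t
    · simp only [deg, Sum.elim_inl, Sum.elim_inr] at ht
      omega
    · simp only [deg, Sum.elim_inr] at ht
      omega

lemma pos_of_mem_noetherLefschetzLocus [FiniteDimensional ℝ V] {ζ : V} (hζ : ζ ≠ 0)
    (hx : x ∈ noetherLefschetzLocus Q m h ζ) : 0 < h m ∧ 0 < Q ζ ζ := by
  have hne : (1 : ℂ) ⊗ₜ[ℝ] ζ ≠ 0 := fun h0 => hζ (by simpa using congrArg rePart h0)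
  constructor
  · rw [← hx.1.2 m m (by omega)]
    have : Nontrivial (hodgePart x m m) :=
      ⟨⟨⟨_, hx.2⟩, 0, fun h0 => hne (congrArg Subtype.val h0)⟩⟩
    exact Module.finrank_pos
  · have h1 := (isPolarizedFlag_of_mem hx.1).herm_self_pos (p := m) (by omega)
      (u := (1 : ℂ) ⊗ₜ[ℝ] ζ) (by rw [show 2 * m - m = m by omega]; exact hx.2) hne
    rw [herm_tmul_tmul, Even.neg_one_pow ⟨m, rfl⟩, one_mul, Complex.ofReal_re] at h1
    exact h1

/-- `u` collects the equations of the period domain and `w` the coordinates `(i, k₀)` with `deg i >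
m`. The neighbourhood `U` is where the joint derivative stays surjective and the Gram matrices stay
close enough to diagonal for positivity. -/
theorem isComplexSubmanifoldOfCodim_noetherLefschetzLocus [FiniteDimensional ℝ V]
    (hs : Q.IsSymm) {ζ : V} (hζ : ζ ≠ 0) :
    IsComplexSubmanifoldOfCodim (noetherLefschetzLocus Q m h ζ) (periodDomain Q (2 * m) h)
      (∑ p ∈ Finset.Icc (m + 1) (2 * m), h p) := by
  classical
  refine ⟨fun y hy => hy.1, fun x hx => ?_⟩
  obtain ⟨hpos, hQζ⟩ := pos_of_mem_noetherLefschetzLocus hζ hx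
  have hx' := mem_noetherLefschetzLocus_iff.1 hx
  have hP := isPolarizedFlag_of_mem hx.1
  obtain ⟨e, he, heζ⟩ := hP.exists_isHodgeBasis hs hx.1 hx'.2
  have hspan := he.span_eq hP
  have hc : ((√(Q ζ ζ) : ℝ) : ℂ) ≠ 0 := by
    exact_mod_cast (Real.sqrt_pos.2 hQζ).ne'
  let k₀ : Fin (h m) := ⟨0, hpos⟩
  let L : ℕ → HodgeIndex m h → HodgeIndex m h → (gradedChart e deg hspan).Coord →L[ℂ] ℂ :=
    fun p i j => LinearMap.toContinuousLinearMap (gradedCoord hspan p i j)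
  have ha : ∀ z p i j, ¬ (p ≤ deg i ∧ deg j < p) → L p i j z = 0 := fun z p i j hij =>
    gradedCoord_eq_zero hspan hij z
  have hstep : ∀ z p, step ((gradedChart e deg hspan).param z) p =
      graphSpan e deg (fun i j => L p i j z) p := fun z p =>
    step_gradedChart_param hspan deg_le z p
  let iu := Fintype.equivFin (ChainIndex m h ⊕ PairIndex m h)
  let iw := Fintype.equivFinOfCardEq (card_upper (m := m) (h := h))
  let u : (gradedChart e deg hspan).Coord → (Fin (Fintype.card (ChainIndex m h ⊕ PairIndex m h)) → ℂ) :=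
    fun z r => equations L z (iu.symm r)
  let w : (gradedChart e deg hspan).Coord → (Fin (∑ p ∈ Finset.Icc (m + 1) (2 * m), h p) → ℂ) :=
    fun z r => L (deg (Sum.inl (Sum.inl (iw.symm r)) : HodgeIndex m h))
      (Sum.inl (Sum.inl (iw.symm r))) (Sum.inr k₀) z
  have hu : ContDiff ℂ 1 u := contDiff_pi.2 fun r => contDiff_equations L _
  have hw : ContDiff ℂ 1 w := contDiff_pi.2 fun r => ContinuousLinearMap.contDiff _
  have hderiv : HasFDerivAt (fun z => (u z, w z))
      ((ContinuousLinearMap.pi fun r => linearEquations L (iu.symm r)).prod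
        (ContinuousLinearMap.pi fun r => L (deg (Sum.inl (Sum.inl (iw.symm r)) : HodgeIndex m h))
          (Sum.inl (Sum.inl (iw.symm r))) (Sum.inr k₀))) 0 :=
    (hasFDerivAt_pi.2 fun r => hasFDerivAt_equations L _).prodMk
      (hasFDerivAt_pi.2 fun r => ContinuousLinearMap.hasFDerivAt _)
  have hsurj : Function.Surjective (fderiv ℂ (fun z => (u z, w z)) 0) := by
    rw [hderiv.fderiv]
    rintro ⟨y, ω⟩
    obtain ⟨z, hz, hz'⟩ := exists_linearEquations_eq L
      (fun f => exists_gradedCoord_eq hspan deg_le f) k₀ (fun t => y (iu t))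
      (Sum.elim (Sum.elim (fun t => ω (iw t)) fun _ => 0) fun _ => 0)
    rw [forall_deg_gt_iff] at hz'
    refine ⟨z, Prod.ext (funext fun r => ?_) (funext fun r => ?_)⟩
    · exact (hz (iu.symm r)).trans (by rw [Equiv.apply_symm_apply])
    · exact (hz' (iw.symm r)).trans (by simp)
  -- With `N` the number of indices, `δ = 1 / (3 N + 3)` gives `3 δ N = N / (N + 1) < 1`, also when
  -- `N = 0`.
  have hδ : 0 < 1 / (3 * (Fintype.card (HodgeIndex m h) : ℝ) + 3) := by positivity
  have hδ' : 3 * (1 / (3 * (Fintype.card (HodgeIndex m h) : ℝ) + 3) *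
      Fintype.card (HodgeIndex m h)) < 1 := by
    rw [← mul_assoc, mul_one_div, div_mul_eq_mul_div, div_lt_one (by positivity)]
    linarith
  have hev := (eventually_surjective_fderiv (hu.prodMk hw) hsurj).and
    (eventually_herm_graphVec_close he L hδ (2 * m + 1))
  obtain ⟨U, hU, hUo, h0⟩ := eventually_nhds_iff.1 hev
  have hD : ∀ z ∈ U, ((gradedChart e deg hspan).param z ∈ periodDomain Q (2 * m) h ↔ u z = 0) := by
    intro z hz
    rw [mem_periodDomain_iff_of_graph hs hx.1 he (ha z) (hstep z)
      (isPositive_of_graph (ha z) (hstep z) hδ' (hU z hz).2)]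
    have h1 : u z = 0 ↔ ∀ t, equations L z t = 0 := by
      rw [funext_iff, iu.symm.forall_congr_left]
      simp [u]
    rw [h1, equations_eq_zero_iff]
    refine and_congr_right fun _ => forall₃_congr fun i k _ => ?_
    rw [he.baseChange_graphVec, pairEquation]
  refine ⟨gradedChart e deg hspan, _, U, u, w, hUo, h0,
    (hu.differentiable one_ne_zero).differentiableOn,
    (hw.differentiable one_ne_zero).differentiableOn, fun z hz => (hU z hz).1, hD, ?_⟩
  intro z hz
  rw [mem_noetherLefschetzLocus_iff, hD z hz]
  refine and_congr_right fun hz0 => ?_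
  rw [mem_step_iff_of_graph he ((hD z hz).2 hz0) (ha z) (hstep z) hc (heζ k₀ rfl),
    forall_deg_gt_iff, funext_iff, iw.symm.forall_congr_left]
  simp [w]

end Submanifold

/-! ### Holomorphy of the real group action. -/

section Homogeneity

variable {V : Type*} [AddCommGroup V] [Module ℝ V] {Q : LinearMap.BilinForm ℝ V} {m : ℕ}
  {h : ℕ → ℕ} {x : Family (ℂ ⊗[ℝ] V) (2 * m)}

lemma complexify_actsHolomorphicallyAt [FiniteDimensional ℝ V] (hs : Q.IsSymm)
    (hx : x ∈ periodDomain Q (2 * m) h) (g : V ≃ₗ[ℝ] V) :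
    ActsHolomorphicallyAt (complexify g) x := by
  have hP := isPolarizedFlag_of_mem hx
  obtain ⟨e, he, -⟩ := hP.exists_isHodgeBasis hs hx (ζ := 0) (by simp)
  exact actsHolomorphicallyAt (gradedChart e deg (he.span_eq hP))
    (LinearEquiv.ofBijective (complexify g) ⟨complexify_injective g, complexify_surjective g⟩)

end Homogeneity

end NoetherLefschetz

open NoetherLefschetz in
theorem proposition5p4 {V : Type*} [AddCommGroup V] [Module ℝ V] [FiniteDimensional ℝ V]
    (Q : LinearMap.BilinForm ℝ V) (hQ : Q.Nondegenerate) (hsymm : Q.IsSymm)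
    (m : ℕ) (h : ℕ → ℕ)
    (F : Family (TensorProduct ℝ ℂ V) (2 * m)) (hF : F ∈ periodDomain Q (2 * m) h)
    (ζ : V) (hζ : ζ ≠ 0) (hζF : IsOfType F ζ m m) :
    noetherLefschetzLocus Q m h ζ = orbit (lineStabilizer Q ζ) F ∧
    IsHomogeneousUnder (lineStabilizer Q ζ) (noetherLefschetzLocus Q m h ζ) ∧
    IsComplexSubmanifoldOfCodim (noetherLefschetzLocus Q m h ζ) (periodDomain Q (2 * m) h)
      (∑ p ∈ Finset.Icc (m + 1) (2 * m), h p) := by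
  have hF' : F ∈ noetherLefschetzLocus Q m h ζ := ⟨hF, hζF⟩
  refine ⟨Set.ext fun x => ⟨fun hx => ?_, ?_⟩, ⟨⟨F, hF'⟩, ?_, ?_, ?_⟩,
    isComplexSubmanifoldOfCodim_noetherLefschetzLocus hsymm hζ⟩
  · obtain ⟨g, hg, rfl⟩ := exists_translate_eq hsymm hζ hF' hx
    exact ⟨g, hg, rfl⟩
  · rintro ⟨g, hg, rfl⟩
    exact translate_mem_noetherLefschetzLocus hsymm hF' hg
  · exact fun g hg x hx => translate_mem_noetherLefschetzLocus hsymm hx hg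
  · exact fun x hx y hy => exists_translate_eq hsymm hζ hx hy
  · exact fun g _ x hx => complexify_actsHolomorphicallyAt hsymm hx.1 g
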